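/- Let $\mathcal X$ be a finite alphabet and $P_1,P_2$ probability distributions on $\mathcal X$. For distributions $P,Q$ on $\mathcal X$ and $\alpha\ge 0$ let $\mathrm{GJS}(P,Q,\alpha)=\alpha D(P\|P_\alpha)+D(Q\|P_\alpha)$ with $P_\alpha=\frac{\alpha P+Q}{1+\alpha}$, where $D$ is the Kullback–Leibler divergence, and let $C(P,Q)=-\inf_{\eta\in[0,1]}\log\sum_{x}P(x)^{\eta}Q(x)^{1-\eta}\in[0,\infty]$ be the Chernoff information. Let $0<\gamma\le C(P_1,P_2)$, $\gamma<\infty$, and, if $\gamma=C(P_1,P_2)$, assume that $P_1$ and $P_2$ have the same support. For $N\in\mathbb N$, let $X_1^N$ and $X_2^N$ be training sequences with i.i.d. entries of law $P_1$ and $P_2$, and let $Y_1,Y_2,\dots$ be test samples, i.i.d. of law $P_i$ under hypothesis $H_i$ ($i=1,2$), all independent; $\mathrm P_i$ and $\mathbb E_i$ are probability and expectation under $H_i$. Let $\mathrm{type}(x^n)$ be the empirical distribution of $x^n$, and let $S_i(n)=n\,\mathrm{GJS}(\mathrm{type}(X_i^N),\mathrm{type}(Y^n),N/n)$. The test $\Phi_{\rm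 seq}(\gamma)=(T,d)$ stops at $$T=\inf\{n\ge 1:\ S_1(n)\ge\gamma N\ \text{or}\ S_2(n)\ge\gamma N\}\wedge N^2,$$ and, on the basis of $(X_1^N,X_2^N,Y^T)$, decides $d=H_1$ if $S_2(T)\ge\gamma N>S_1(T)$, $d=H_2$ if $S_1(T)\ge\gamma N>S_2(T)$, and arbitrarily (as a function of $(X_1^N,X_2^N,Y^T)$) in the remaining cases. Then there are a unique $\beta^\star_\gamma>0$ with $\mathrm{GJS}(P_2,P_1,\beta^\star_\gamma)=\gamma\beta^\star_\gamma$ and a unique $\theta^\star_\gamma>0$ with $\mathrm{GJS}(P_1,P_2,\theta^\star_\gamma)=\gamma\theta^\star_\gamma$, and, for any choice of the arbitrary decisions, as $N\to\infty$: - $\mathrm P_1(d\ne H_1)\stackrel{.}{\le}\exp(-N\gamma)$ and $\mathbb E_1[T]=\frac{N}{\beta^\star_\gamma}(1+o(1))$; - $\mathrm P_2(d\ne H_2)\stackrel{.}{\le}\exp(-N\gamma)$ and $\mathbb E_2[T]=\frac{N}{\theta^\star_\gamma}(1+o(1))$. Here $a_N\stackrel{.}{\le}b_N$ means $\limsup_{N\to\infty}\frac1N\log\frac{a_N}{b_N}\le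 0$, with $\log 0=-\infty$. -/

import Mathlib

open MeasureTheory Filter Asymptotics
open scoped ENNReal

noncomputable section

namespace SeqClassification

/-- The two hypotheses (also the two possible decisions). -/
inductive Hypothesis
  | H₁
  | H₂

/-- The probability mass function of `P`, with real values. -/
def pmfReal {𝒳 : Type*} (P : PMF 𝒳) : 𝒳 → ℝ := fun a => (P a).toReal

open Classical in
/-- The type (empirical distribution) of a sequence `x` of length `n`. -/
def empDist {𝒳 : Type*} {n : ℕ} (x : Fin n → 𝒳) : 𝒳 → ℝ :=
  fun a => (1 / (n : ℝ)) * ∑ i : Fin n, if x i = a then (1 : ℝ) else 0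

/-- Kullback-Leibler divergence `D(P‖Q)` of mass functions on a finite alphabet, for `P` absolutely
continuous with respect to `Q`; this is the only case in which it is used below. -/
def klSum {𝒳 : Type*} [Fintype 𝒳] (P Q : 𝒳 → ℝ) : ℝ :=
  ∑ a, P a * Real.log (P a / Q a)

/-- The mixture `P_α = (α P + Q) / (1 + α)`. -/
def mixture {𝒳 : Type*} (P Q : 𝒳 → ℝ) (α : ℝ) : 𝒳 → ℝ :=
  fun a => (α * P a + Q a) / (1 + α)

/-- Generalized Jensen-Shannon divergence `GJS(P, Q, α) = α D(P‖P_α) + D(Q‖P_α)`. -/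
def gjs {𝒳 : Type*} [Fintype 𝒳] (P Q : 𝒳 → ℝ) (α : ℝ) : ℝ :=
  α * klSum P (mixture P Q α) + klSum Q (mixture P Q α)

/-- Chernoff information; it is `⊤` exactly when `P` and `Q` are mutually singular. -/
def chernoffInfo {𝒳 : Type*} [Fintype 𝒳] (P Q : PMF 𝒳) : EReal :=
  -(⨅ η ∈ Set.Icc (0 : ℝ) 1, ENNReal.log (∑ a, P a ^ η * Q a ^ (1 - η)))

/-- The first `n` test samples `Y₁, …, Yₙ`. -/
def firstSamples {𝒳 : Type*} (y : ℕ → 𝒳) (n : ℕ) : Fin n → 𝒳 := fun k => y k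

/-- The score `n · GJS(type(x), type(yⁿ), N / n)` of a training sequence `x` at time `n`. -/
def score {𝒳 : Type*} [Fintype 𝒳] {N : ℕ} (x : Fin N → 𝒳) (y : ℕ → 𝒳) (n : ℕ) : ℝ :=
  n * gjs (empDist x) (empDist (firstSamples y n)) ((N : ℝ) / n)

/-- The stopping time `T_seq`: the first time `n ≥ 1` at which one of the two scores is at
least `γ N`, or `N ^ 2` if there is no such time up to `N ^ 2`. -/
def stopTime {𝒳 : Type*} [Fintype 𝒳] (γ : ℝ) {N : ℕ} (x₁ x₂ : Fin N → 𝒳) (y : ℕ → 𝒳) : ℕ :=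
  sInf (insert (N ^ 2) {n : ℕ | 1 ≤ n ∧ (γ * N ≤ score x₁ y n ∨ γ * N ≤ score x₂ y n)})

/-- `d` is a decision rule `d_seq` of the test: it depends on the test sequence only through the
samples observed up to the stopping time, it declares `H₁` if at that time the score of the second
training sequence has reached the threshold, and `H₂` if the score of the first one has.
If both have, or none has (at time `N ^ 2`), the decision is arbitrary. -/
structure IsSeqRule {𝒳 : Type*} [Fintype 𝒳] (γ : ℝ) (N : ℕ)
    (d : (Fin N → 𝒳) → (Fin N → 𝒳) → (ℕ → 𝒳) → Hypothesis) : Prop where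
  adapted : ∀ x₁ x₂ y y', (∀ k < stopTime γ x₁ x₂ y, y k = y' k) → d x₁ x₂ y = d x₁ x₂ y'
  declare₁ : ∀ x₁ x₂ y, γ * N ≤ score x₂ y (stopTime γ x₁ x₂ y) →
    ¬ γ * N ≤ score x₁ y (stopTime γ x₁ x₂ y) → d x₁ x₂ y = Hypothesis.H₁
  declare₂ : ∀ x₁ x₂ y, γ * N ≤ score x₁ y (stopTime γ x₁ x₂ y) →
    ¬ γ * N ≤ score x₂ y (stopTime γ x₁ x₂ y) → d x₁ x₂ y = Hypothesis.H₂

/-- The distribution that generates the test sequence under each hypothesis. -/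
def testDist {𝒳 : Type*} (P₁ P₂ : PMF 𝒳) : Hypothesis → PMF 𝒳
  | Hypothesis.H₁ => P₁
  | Hypothesis.H₂ => P₂

/-- The joint law, under hypothesis `h`, of the two training sequences of length `N` (i.i.d. `P₁`
and i.i.d. `P₂`) and of the infinite test sequence, all independent. -/
def law {𝒳 : Type*} [MeasurableSpace 𝒳] (P₁ P₂ : PMF 𝒳) (N : ℕ) (h : Hypothesis) :
    Measure ((Fin N → 𝒳) × (Fin N → 𝒳) × (ℕ → 𝒳)) :=
  (Measure.pi fun _ : Fin N => P₁.toMeasure).prod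
    ((Measure.pi fun _ : Fin N => P₂.toMeasure).prod
      (Measure.infinitePi fun _ : ℕ => (testDist P₁ P₂ h).toMeasure))

/-- The error probability of the decision rule `d` under hypothesis `h`. -/
def errProb {𝒳 : Type*} [MeasurableSpace 𝒳] (P₁ P₂ : PMF 𝒳) (N : ℕ)
    (d : (Fin N → 𝒳) → (Fin N → 𝒳) → (ℕ → 𝒳) → Hypothesis) (h : Hypothesis) : ℝ :=
  (law P₁ P₂ N h).real {ω | d ω.1 ω.2.1 ω.2.2 ≠ h}

/-- The expected value of the stopping time under hypothesis `h`. -/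
def expStopTime {𝒳 : Type*} [Fintype 𝒳] [MeasurableSpace 𝒳] (P₁ P₂ : PMF 𝒳) (γ : ℝ) (N : ℕ)
    (h : Hypothesis) : ℝ :=
  ∫ ω, (stopTime γ ω.1 ω.2.1 ω.2.2 : ℝ) ∂(law P₁ P₂ N h)

/-- `a ≲ b` to first order in the exponent: `limsup (1 / n) log (a n / b n) ≤ 0`, with
`log 0 = -∞`, written without logarithms; `b` is positive wherever this is used. -/
def ExpLE (a b : ℕ → ℝ) : Prop :=
  ∀ ε : ℝ, 0 < ε → ∀ᶠ n : ℕ in atTop, a n / b n ≤ Real.exp (ε * n)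

end SeqClassification

end

namespace SeqClassification

/-! ### Kullback–Leibler and generalized Jensen–Shannon divergences. -/

section Divergence

variable {𝒳 : Type*} [Fintype 𝒳]

/-! The score is a minimum: by the compensation identity `klSum_add_klSum_eq`, `gjs P Q α` is the
least value of α D(P‖R) + D(Q‖R) over R. Under H₁ the first training sequence and the test sequence
share the law P₁. Taking R = P₁ bounds S₁(n) by the exponent that the method of types
(`measureReal_pair_le`) attaches to the observed types, so S₁ reaches γN by time N² with probability
at most a polynomial times exp(-γN).

If S₁ never reaches γN, an error forces S₂(N²) < γN. At that time α = 1/N, and either the test type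
alone costs an exponent γN, or it is close to P₁ and so is its mixture M with the training type A.
Then D(A‖M) < γ, and the variational bound `exp_neg_klSum_le` gives D(A‖P₂) ≥ γ - ε. The assumption
on γ enters as an η in (0, 1) with ∑ P₁^η P₂^(1-η) ≤ exp(-γ) (`exists_chernoff_sum_le`).

For the mean, S₂(n) ≥ γN says `gjs` ≥ γα at α = N/n. The ratio `gjs`/α strictly decreases in α,
exceeds γ near 0 by the same Chernoff bound, and falls below γ because `gjs` grows at most
logarithmically; this gives the unique root β. For typical sequences the crossing occurs near N/β
(`stopTime_bounds_of_typical`), and since T ≤ N² an exceptional event of probability O(N⁻²) adds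
only O(1) to the mean. H₂ reduces to H₁ by exchanging the training sequences. -/

theorem le_one_of_mem_simplex {P : 𝒳 → ℝ} (hP : P ∈ stdSimplex ℝ 𝒳) (a : 𝒳) : P a ≤ 1 :=
  hP.2 ▸ Finset.single_le_sum (fun b _ => hP.1 b) (Finset.mem_univ a)

/-- This is log t ≤ t - 1 at t = √q / √p. The linear terms p - q cancel when summed over the
alphabet. -/
theorem sq_sqrt_sub_sqrt_le {p q : ℝ} (hp : 0 ≤ p) (hq : 0 ≤ q) (h : q = 0 → p = 0) :
    (√p - √q) ^ 2 + p - q ≤ p * Real.log (p / q) := by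
  rcases hp.eq_or_lt with rfl | hp
  · simp [Real.sq_sqrt hq]
  have hq : 0 < q := lt_of_le_of_ne hq fun h0 => hp.ne' (h h0.symm)
  have hlog : Real.log (p / q) = -(2 * Real.log (√q / √p)) := by
    rw [Real.log_div (by positivity) (by positivity), Real.log_div (by positivity) (by positivity),
      Real.log_sqrt hp.le, Real.log_sqrt hq.le]
    ring
  have h1 := Real.log_le_sub_one_of_pos (x := √q / √p) (by positivity)
  have h2 : p * (√q / √p) = √p * √q := by
    nth_rewrite 1 [← Real.mul_self_sqrt hp.le]
    field_simp
  rw [hlog]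
  nlinarith [Real.sq_sqrt hp.le, Real.sq_sqrt hq.le, mul_le_mul_of_nonneg_left h1 hp.le]

/-- The Kullback-Leibler divergence dominates the squared Hellinger distance. -/
theorem hellinger_le_klSum {P Q : 𝒳 → ℝ} (hP : P ∈ stdSimplex ℝ 𝒳) (hQ : Q ∈ stdSimplex ℝ 𝒳)
    (hPQ : ∀ a, Q a = 0 → P a = 0) : ∑ a, (√(P a) - √(Q a)) ^ 2 ≤ klSum P Q := by
  have h := Finset.sum_le_sum fun a (_ : a ∈ Finset.univ) =>
    sq_sqrt_sub_sqrt_le (hP.1 a) (hQ.1 a) (hPQ a)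
  rw [Finset.sum_sub_distrib, Finset.sum_add_distrib, hP.2, hQ.2] at h
  simpa [klSum] using h

theorem klSum_nonneg {P Q : 𝒳 → ℝ} (hP : P ∈ stdSimplex ℝ 𝒳) (hQ : Q ∈ stdSimplex ℝ 𝒳)
    (hPQ : ∀ a, Q a = 0 → P a = 0) : 0 ≤ klSum P Q :=
  (Finset.sum_nonneg fun _ _ => sq_nonneg _).trans (hellinger_le_klSum hP hQ hPQ)

/-- A pointwise substitute for Pinsker's inequality: factor p - q through √p ± √q, where √p + √q ≤
2. -/
theorem sq_sub_le_klSum {P Q : 𝒳 → ℝ} (hP : P ∈ stdSimplex ℝ 𝒳) (hQ : Q ∈ stdSimplex ℝ 𝒳)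
    (hPQ : ∀ a, Q a = 0 → P a = 0) (a : 𝒳) : (P a - Q a) ^ 2 ≤ 4 * klSum P Q := by
  have h1 : (√(P a) - √(Q a)) ^ 2 ≤ klSum P Q :=
    (Finset.single_le_sum (f := fun a => (√(P a) - √(Q a)) ^ 2) (fun _ _ => sq_nonneg _)
      (Finset.mem_univ a)).trans (hellinger_le_klSum hP hQ hPQ)
  have hp : √(P a) ≤ 1 := Real.sqrt_le_one.2 (le_one_of_mem_simplex hP a)
  have hq : √(Q a) ≤ 1 := Real.sqrt_le_one.2 (le_one_of_mem_simplex hQ a)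
  have h2 : (P a - Q a) ^ 2 = (√(P a) + √(Q a)) ^ 2 * (√(P a) - √(Q a)) ^ 2 := by
    rw [← mul_pow, ← sq_sub_sq, Real.sq_sqrt (hP.1 a), Real.sq_sqrt (hQ.1 a)]
  have h3 : (√(P a) + √(Q a)) ^ 2 ≤ 4 := by
    nlinarith [Real.sqrt_nonneg (P a), Real.sqrt_nonneg (Q a)]
  rw [h2]
  exact mul_le_mul h3 h1 (sq_nonneg _) (by norm_num)

theorem klSum_pos {P Q : 𝒳 → ℝ} (hP : P ∈ stdSimplex ℝ 𝒳) (hQ : Q ∈ stdSimplex ℝ 𝒳)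
    (hPQ : ∀ a, Q a = 0 → P a = 0) (hne : P ≠ Q) : 0 < klSum P Q := by
  obtain ⟨a, ha⟩ := Function.ne_iff.1 hne
  have h := sq_sub_le_klSum hP hQ hPQ a
  have h' : 0 < (P a - Q a) ^ 2 := by
    have := sub_ne_zero.2 ha
    positivity
  linarith

@[simp]
theorem klSum_self (P : 𝒳 → ℝ) : klSum P P = 0 := by
  refine Finset.sum_eq_zero fun a _ => ?_
  by_cases h : P a = 0 <;> simp [h]

theorem mixture_mem_simplex {P Q : 𝒳 → ℝ} (hP : P ∈ stdSimplex ℝ 𝒳) (hQ : Q ∈ stdSimplex ℝ 𝒳)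
    {α : ℝ} (hα : 0 ≤ α) : mixture P Q α ∈ stdSimplex ℝ 𝒳 := by
  refine ⟨fun a => ?_, ?_⟩
  · have := hP.1 a
    have := hQ.1 a
    unfold mixture
    positivity
  · simp only [mixture]
    rw [← Finset.sum_div, Finset.sum_add_distrib, ← Finset.mul_sum, hP.2, hQ.2]
    field_simp
    ring

theorem eq_zero_of_mixture_eq_zero {P Q : 𝒳 → ℝ} (hP : P ∈ stdSimplex ℝ 𝒳)
    (hQ : Q ∈ stdSimplex ℝ 𝒳) {α : ℝ} (hα : 0 < α) {a : 𝒳} (h : mixture P Q α a = 0) :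
    P a = 0 ∧ Q a = 0 := by
  have h1 := hP.1 a
  have h2 := hQ.1 a
  have h3 : 1 + α ≠ 0 := by positivity
  have h4 : α * P a + Q a = 0 := by simpa [mixture, h3] using h
  have h5 := mul_nonneg hα.le h1
  refine ⟨?_, by linarith⟩
  have : α * P a = 0 := by linarith
  simpa [hα.ne'] using this

theorem abs_mixture_sub_le {P Q : 𝒳 → ℝ} (hP : P ∈ stdSimplex ℝ 𝒳) (hQ : Q ∈ stdSimplex ℝ 𝒳)
    {α : ℝ} (hα : 0 ≤ α) (a : 𝒳) : |mixture P Q α a - Q a| ≤ α := by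
  have h : mixture P Q α a - Q a = α * (P a - Q a) / (1 + α) := by
    unfold mixture
    field_simp
    ring
  have h1 : |P a - Q a| ≤ 1 := by
    rw [abs_le]
    constructor <;> linarith [hP.1 a, hQ.1 a, le_one_of_mem_simplex hP a, le_one_of_mem_simplex hQ a]
  rw [h, abs_div, abs_mul, abs_of_nonneg hα, abs_of_nonneg (by positivity : 0 ≤ 1 + α),
    div_le_iff₀ (by positivity)]
  nlinarith [mul_nonneg hα hα, mul_le_mul_of_nonneg_left h1 hα]

theorem mul_log_div_eq {p m r : ℝ} (hm : m = 0 → p = 0) (hr : r = 0 → m = 0) :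
    p * Real.log (p / r) = p * Real.log (p / m) + p * Real.log (m / r) := by
  by_cases hp : p = 0
  · simp [hp]
  have hm0 : m ≠ 0 := fun h => hp (hm h)
  have hr0 : r ≠ 0 := fun h => hm0 (hr h)
  rw [← mul_add, ← Real.log_mul (by positivity) (by positivity)]
  congr 2
  field_simp

/-- The compensation identity: the weighted sum of divergences exceeds its minimum `gjs P Q α`,
attained at the mixture, by a multiple of a divergence. -/
theorem klSum_add_klSum_eq {P Q R : 𝒳 → ℝ} (hP : P ∈ stdSimplex ℝ 𝒳) (hQ : Q ∈ stdSimplex ℝ 𝒳)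
    {α : ℝ} (hα : 0 < α) (hPR : ∀ a, R a = 0 → P a = 0) (hQR : ∀ a, R a = 0 → Q a = 0) :
    α * klSum P R + klSum Q R = gjs P Q α + (1 + α) * klSum (mixture P Q α) R := by
  simp only [gjs, klSum, Finset.mul_sum, ← Finset.sum_add_distrib]
  refine Finset.sum_congr rfl fun a _ => ?_
  have hr : R a = 0 → mixture P Q α a = 0 := fun h => by simp [mixture, hPR a h, hQR a h]
  rw [mul_log_div_eq (fun h => (eq_zero_of_mixture_eq_zero hP hQ hα h).1) hr,
    mul_log_div_eq (p := Q a) (fun h => (eq_zero_of_mixture_eq_zero hP hQ hα h).2) hr]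
  have : (1 + α) * mixture P Q α a = α * P a + Q a := by
    unfold mixture
    field_simp
  rw [← mul_assoc (1 + α), this]
  ring

theorem gjs_le_klSum_add_klSum {P Q R : 𝒳 → ℝ} (hP : P ∈ stdSimplex ℝ 𝒳)
    (hQ : Q ∈ stdSimplex ℝ 𝒳) (hR : R ∈ stdSimplex ℝ 𝒳) {α : ℝ} (hα : 0 < α)
    (hPR : ∀ a, R a = 0 → P a = 0) (hQR : ∀ a, R a = 0 → Q a = 0) :
    gjs P Q α ≤ α * klSum P R + klSum Q R := by
  rw [klSum_add_klSum_eq hP hQ hα hPR hQR]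
  have := klSum_nonneg (mixture_mem_simplex hP hQ hα.le) hR
    fun a h => by simp [mixture, hPR a h, hQR a h]
  have : 0 ≤ (1 + α) * klSum (mixture P Q α) R := by positivity
  linarith

theorem mul_klSum_mixture_le_gjs {P Q : 𝒳 → ℝ} (hP : P ∈ stdSimplex ℝ 𝒳)
    (hQ : Q ∈ stdSimplex ℝ 𝒳) {α : ℝ} (hα : 0 < α) : α * klSum P (mixture P Q α) ≤ gjs P Q α :=
  le_add_of_nonneg_right <| klSum_nonneg hQ (mixture_mem_simplex hP hQ hα.le)
    fun _ h => (eq_zero_of_mixture_eq_zero hP hQ hα h).2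

/-- `gjs P Q α / α` is strictly decreasing in `α`. -/
theorem gjs_div_lt_gjs_div {P Q : 𝒳 → ℝ} (hP : P ∈ stdSimplex ℝ 𝒳) (hQ : Q ∈ stdSimplex ℝ 𝒳)
    (hne : P ≠ Q) {α α' : ℝ} (hα : 0 < α) (hlt : α < α') :
    gjs P Q α' / α' < gjs P Q α / α := by
  have hα' := hα.trans hlt
  have hM := mixture_mem_simplex hP hQ hα.le
  have h1 := gjs_le_klSum_add_klSum hP hQ hM hα'
    (fun _ h => (eq_zero_of_mixture_eq_zero hP hQ hα h).1)
    (fun _ h => (eq_zero_of_mixture_eq_zero hP hQ hα h).2)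
  have h2 : 0 < klSum Q (mixture P Q α) := by
    refine klSum_pos hQ hM (fun _ h => (eq_zero_of_mixture_eq_zero hP hQ hα h).2) fun h => hne ?_
    ext a
    have h3 := congrFun h a
    simp only [mixture] at h3
    field_simp at h3
    have : α * (P a - Q a) = 0 := by linarith
    simpa [hα.ne', sub_eq_zero] using this
  rw [div_lt_div_iff₀ hα' hα]
  have h3 : gjs P Q α = α * klSum P (mixture P Q α) + klSum Q (mixture P Q α) := rfl
  rw [h3]
  nlinarith [mul_pos (sub_pos.2 hlt) h2, mul_le_mul_of_nonneg_left h1 hα.le]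

/-- The mixture dominates P α/(1+α) and Q/(1+α), so the two divergences are at most log((1+α)/α) ≤
1/α and log(1+α). -/
theorem gjs_le_log {P Q : 𝒳 → ℝ} (hP : P ∈ stdSimplex ℝ 𝒳) (hQ : Q ∈ stdSimplex ℝ 𝒳)
    {α : ℝ} (hα : 0 < α) : gjs P Q α ≤ 1 + Real.log (1 + α) := by
  have key : ∀ {R : 𝒳 → ℝ} (_ : R ∈ stdSimplex ℝ 𝒳) (c : ℝ) (_ : 0 < c)
      (_ : ∀ a, c * R a ≤ (1 + α) * mixture P Q α a),
      klSum R (mixture P Q α) ≤ Real.log ((1 + α) / c) := by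
    intro R hR c hc h
    calc klSum R (mixture P Q α) ≤ ∑ a, R a * Real.log ((1 + α) / c) := by
          refine Finset.sum_le_sum fun a _ => ?_
          rcases (hR.1 a).eq_or_lt with h0 | h0
          · simp [← h0]
          have hm : 0 < mixture P Q α a := by
            have := (mul_pos hc h0).trans_le (h a)
            exact pos_of_mul_pos_right this (by positivity)
          refine mul_le_mul_of_nonneg_left (Real.log_le_log (by positivity) ?_) h0.le
          rw [div_le_div_iff₀ hm hc]
          linarith [h a]
      _ = _ := by rw [← Finset.sum_mul, hR.2, one_mul]
  have hm : ∀ a, (1 + α) * mixture P Q α a = α * P a + Q a := fun a => by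
    unfold mixture
    field_simp
  have h1 := key hP α hα fun a => by rw [hm]; linarith [hQ.1 a]
  have h2 := key hQ 1 one_pos fun a => by rw [hm]; linarith [mul_nonneg hα.le (hP.1 a)]
  have h3 : Real.log ((1 + α) / α) ≤ 1 / α := by
    refine (Real.log_le_sub_one_of_pos (by positivity)).trans (le_of_eq ?_)
    field_simp
    ring
  have h4 : α * klSum P (mixture P Q α) ≤ α * (1 / α) :=
    mul_le_mul_of_nonneg_left (h1.trans h3) hα.le
  rw [mul_one_div_cancel hα.ne'] at h4
  rw [div_one] at h2
  unfold gjs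
  linarith

/-- The uniformity in P and Q shows that no score can cross at a time n ≤ N/L, whatever the observed
types. -/
theorem exists_forall_gjs_lt {γ : ℝ} (hγ : 0 < γ) : ∃ L : ℝ, 0 < L ∧
    ∀ α, L ≤ α → ∀ P ∈ stdSimplex ℝ 𝒳, ∀ Q ∈ stdSimplex ℝ 𝒳, gjs P Q α < γ * α := by
  have h : Tendsto (fun α : ℝ => (γ * (1 + α) - Real.log (1 + α)) ) atTop atTop := by
    have h1 : Tendsto (fun x : ℝ => γ * x - Real.log x) atTop atTop := by
      have h2 : (fun x : ℝ => γ * x - Real.log x) ~[atTop] fun x => γ * x := by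
        refine IsEquivalent.sub_isLittleO IsEquivalent.refl ?_
        exact Real.isLittleO_log_id_atTop.const_mul_right hγ.ne'
      exact h2.symm.tendsto_atTop (tendsto_id.const_mul_atTop hγ)
    exact h1.comp (tendsto_atTop_add_const_left _ _ tendsto_id)
  obtain ⟨L, hL⟩ := eventually_atTop.1 (h.eventually_gt_atTop (1 + γ))
  refine ⟨max L 1, by positivity, fun α hα P hP Q hQ => ?_⟩
  have h1 := hL α ((le_max_left _ _).trans hα)
  have h2 := gjs_le_log hP hQ (one_pos.trans_le ((le_max_right L 1).trans hα))
  linarith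

/-- In this form continuity at distributions with zero masses is visible, since t log t is
continuous at 0. -/
theorem gjs_eq_negMulLog {P Q : 𝒳 → ℝ} (hP : P ∈ stdSimplex ℝ 𝒳) (hQ : Q ∈ stdSimplex ℝ 𝒳)
    {α : ℝ} (hα : 0 < α) : gjs P Q α = (1 + α) * ∑ a, Real.negMulLog (mixture P Q α a)
      - α * ∑ a, Real.negMulLog (P a) - ∑ a, Real.negMulLog (Q a) := by
  simp only [gjs, klSum, Finset.mul_sum, ← Finset.sum_add_distrib, ← Finset.sum_sub_distrib]
  refine Finset.sum_congr rfl fun a _ => ?_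
  have h0 := @eq_zero_of_mixture_eq_zero _ _ P Q hP hQ α hα a
  have hm : (1 + α) * mixture P Q α a = α * P a + Q a := by
    unfold mixture
    field_simp
  have key : ∀ p : ℝ, (mixture P Q α a = 0 → p = 0) → p * Real.log (p / mixture P Q α a)
      = p * Real.log p - p * Real.log (mixture P Q α a) := by
    intro p hp
    by_cases h : p = 0
    · simp [h]
    · rw [Real.log_div h fun h' => h (hp h'), mul_sub]
  rw [key _ fun h => (h0 h).1, key _ fun h => (h0 h).2]
  simp only [Real.negMulLog]
  linear_combination Real.log (mixture P Q α a) * hm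

/-- The expression of `gjs` by entropies is jointly continuous. -/
theorem continuousAt_entropy_diff {x : ((𝒳 → ℝ) × (𝒳 → ℝ)) × ℝ} (hx : 0 < x.2) :
    ContinuousAt (fun x : ((𝒳 → ℝ) × (𝒳 → ℝ)) × ℝ =>
      (1 + x.2) * ∑ a, Real.negMulLog (mixture x.1.1 x.1.2 x.2 a)
      - x.2 * ∑ a, Real.negMulLog (x.1.1 a) - ∑ a, Real.negMulLog (x.1.2 a)) x := by
  have h1 : ∀ a, ContinuousAt
      (fun x : ((𝒳 → ℝ) × (𝒳 → ℝ)) × ℝ => mixture x.1.1 x.1.2 x.2 a) x := fun a => by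
    unfold mixture
    exact ContinuousAt.div (by fun_prop) (by fun_prop) (by positivity)
  have h2 : ∀ a, ContinuousAt (fun x : ((𝒳 → ℝ) × (𝒳 → ℝ)) × ℝ =>
      Real.negMulLog (mixture x.1.1 x.1.2 x.2 a)) x := fun a =>
    (Real.continuous_negMulLog.continuousAt).comp (h1 a)
  have h3 := Real.continuous_negMulLog
  fun_prop

theorem continuousOn_gjs {P Q : 𝒳 → ℝ} (hP : P ∈ stdSimplex ℝ 𝒳) (hQ : Q ∈ stdSimplex ℝ 𝒳) :
    ContinuousOn (gjs P Q) (Set.Ioi 0) := by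
  refine ContinuousOn.congr (fun α hα => ContinuousAt.continuousWithinAt ?_)
    fun α hα => gjs_eq_negMulLog hP hQ hα
  exact ContinuousAt.comp (f := fun α : ℝ => ((P, Q), α))
    (continuousAt_entropy_diff (x := ((P, Q), α)) hα) (by fun_prop)

/-- Uniformity of an open condition on `gjs P Q α`, for `α` in a compact interval, near `(P, Q)`. -/
theorem exists_forall_near_gjs {P Q : 𝒳 → ℝ} (hP : P ∈ stdSimplex ℝ 𝒳) (hQ : Q ∈ stdSimplex ℝ 𝒳)
    {a b : ℝ} (ha : 0 < a) {U : Set (ℝ × ℝ)} (hU : IsOpen U)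
    (h : ∀ α ∈ Set.Icc a b, (gjs P Q α, α) ∈ U) :
    ∃ κ > 0, ∀ A ∈ stdSimplex ℝ 𝒳, ∀ B ∈ stdSimplex ℝ 𝒳, (∀ x, |A x - P x| < κ) →
      (∀ x, |B x - Q x| < κ) → ∀ α ∈ Set.Icc a b, (gjs A B α, α) ∈ U := by
  -- Tube lemma, applied to the entropy expression, which is continuous on the whole space; it is
  -- turned back into `gjs` on the simplex only.
  have h1 := isCompact_Icc.eventually_forall_of_forall_eventually (K := Set.Icc a b)
    (x₀ := (P, Q)) (P := fun z α => ((1 + α) * ∑ x, Real.negMulLog (mixture z.1 z.2 α x)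
      - α * ∑ x, Real.negMulLog (z.1 x) - ∑ x, Real.negMulLog (z.2 x), α) ∈ U) (by
    intro α hα
    have hα0 : 0 < α := ha.trans_le hα.1
    have h2 := (continuousAt_entropy_diff (x := ((P, Q), α)) hα0).prodMk
      (continuousAt_snd (p := ((P, Q), α)))
    refine h2.eventually (hU.mem_nhds ?_)
    have h3 := h α hα
    rwa [gjs_eq_negMulLog hP hQ hα0] at h3)
  obtain ⟨κ, hκ, hball⟩ := Metric.eventually_nhds_iff.1 h1
  refine ⟨κ, hκ, fun A hA B hB hAP hBQ α hα => ?_⟩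
  have h3 : dist (A, B) (P, Q) < κ := by
    rw [Prod.dist_eq, max_lt_iff, dist_pi_lt_iff hκ, dist_pi_lt_iff hκ]
    exact ⟨hAP, hBQ⟩
  have := hball h3 α hα
  rwa [← gjs_eq_negMulLog hA hB (ha.trans_le hα.1)] at this

end Divergence

/-! ### Chernoff coefficient, the root of gjs = γα, and the exponent of a missed crossing. -/

section Chernoff

variable {𝒳 : Type*} [Fintype 𝒳]

/-- The variational bound for the Chernoff coefficient. -/
theorem exp_neg_klSum_le {A M Q : 𝒳 → ℝ} (hA : A ∈ stdSimplex ℝ 𝒳) (hM : M ∈ stdSimplex ℝ 𝒳)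
    (hQ : Q ∈ stdSimplex ℝ 𝒳) (hAM : ∀ a, M a = 0 → A a = 0) (hAQ : ∀ a, Q a = 0 → A a = 0)
    (η : ℝ) : Real.exp (-(η * klSum A M + (1 - η) * klSum A Q)) ≤
      ∑ a, M a ^ η * Q a ^ (1 - η) := by
  -- Jensen with weights A: where A > 0, A (M/A)^η (Q/A)^(1-η) = M^η Q^(1-η).
  have h := convexOn_exp.map_sum_le (t := Finset.univ) (w := A)
    (p := fun a => -(η * Real.log (A a / M a) + (1 - η) * Real.log (A a / Q a)))
    (fun a _ => hA.1 a) hA.2 (fun a _ => Set.mem_univ _)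
  have h1 : -(η * klSum A M + (1 - η) * klSum A Q) = ∑ a, A a •
      -(η * Real.log (A a / M a) + (1 - η) * Real.log (A a / Q a)) := by
    simp only [klSum, Finset.mul_sum, ← Finset.sum_add_distrib, ← Finset.sum_neg_distrib, smul_eq_mul]
    exact Finset.sum_congr rfl fun a _ => by ring
  rw [h1]
  refine h.trans (Finset.sum_le_sum fun a _ => ?_)
  rcases (hA.1 a).eq_or_lt with h0 | h0
  · rw [← h0, zero_smul]
    exact mul_nonneg (Real.rpow_nonneg (hM.1 a) _) (Real.rpow_nonneg (hQ.1 a) _)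
  have hm : 0 < M a := lt_of_le_of_ne (hM.1 a) fun h => h0.ne' (hAM a h.symm)
  have hq : 0 < Q a := lt_of_le_of_ne (hQ.1 a) fun h => h0.ne' (hAQ a h.symm)
  rw [Real.rpow_def_of_pos hm, Real.rpow_def_of_pos hq, Real.log_div h0.ne' hm.ne',
    Real.log_div h0.ne' hq.ne', smul_eq_mul, ← Real.exp_add]
  nth_rewrite 1 [← Real.exp_log h0]
  rw [← Real.exp_add]
  exact (congrArg Real.exp (by ring)).le

/-- t ↦ t^η is subadditive for 0 ≤ η ≤ 1, and the other factor is at most 1. For η > 0 the error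
vanishes with r. -/
theorem chernoff_sum_le_of_abs_sub_le {M P Q : 𝒳 → ℝ} (hM : M ∈ stdSimplex ℝ 𝒳)
    (hP : P ∈ stdSimplex ℝ 𝒳) (hQ : Q ∈ stdSimplex ℝ 𝒳) {η : ℝ} (h0 : 0 ≤ η) (h1 : η ≤ 1) {r : ℝ}
    (hr : ∀ a, |M a - P a| ≤ r) : ∑ a, M a ^ η * Q a ^ (1 - η) ≤
      ∑ a, P a ^ η * Q a ^ (1 - η) + Fintype.card 𝒳 * r ^ η := by
  have h2 : (Fintype.card 𝒳 : ℝ) * r ^ η = ∑ _a : 𝒳, r ^ η := by simp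
  rw [h2, ← Finset.sum_add_distrib]
  refine Finset.sum_le_sum fun a _ => ?_
  have hr0 : 0 ≤ r := (abs_nonneg _).trans (hr a)
  have h3 : M a ^ η ≤ P a ^ η + r ^ η :=
    (Real.rpow_le_rpow (hM.1 a) (by linarith [(abs_le.1 (hr a)).2]) h0).trans
      (Real.rpow_add_le_add_rpow (hP.1 a) hr0 h0 h1)
  have h4 : Q a ^ (1 - η) ≤ 1 :=
    Real.rpow_le_one (hQ.1 a) (le_one_of_mem_simplex hQ a) (by linarith)
  have h5 := Real.rpow_nonneg (hQ.1 a) (1 - η)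
  have h6 := Real.rpow_nonneg hr0 η
  nlinarith [mul_le_mul_of_nonneg_right h3 h5]

theorem ne_of_chernoff_sum_lt_one {P Q : 𝒳 → ℝ} (hP : P ∈ stdSimplex ℝ 𝒳) {η : ℝ}
    (h : ∑ a, Q a ^ η * P a ^ (1 - η) < 1) : P ≠ Q := by
  rintro rfl
  refine h.ne ((Finset.sum_congr rfl fun a _ => ?_).trans hP.2)
  rw [← Real.rpow_add' (hP.1 a) (by simp), add_sub_cancel, Real.rpow_one]

/-- Since `gjs`/α ≥ D(P‖P_α), it suffices that this divergence exceeds γ. The variational bound with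
A = P leaves exp(-η D(P‖P_α)) ≤ ∑ P_α^η P^(1-η), whose right side is at most exp(-γ) + o(1) as P_α →
Q, hence eventually below exp(-ηγ) because η < 1. -/
theorem eventually_lt_gjs {P Q : 𝒳 → ℝ} (hP : P ∈ stdSimplex ℝ 𝒳) (hQ : Q ∈ stdSimplex ℝ 𝒳)
    {γ η : ℝ} (hγ : 0 < γ) (h0 : 0 < η) (h1 : η < 1)
    (hη : ∑ a, Q a ^ η * P a ^ (1 - η) ≤ Real.exp (-γ)) :
    ∀ᶠ α : ℝ in nhdsWithin 0 (Set.Ioi 0), γ * α < gjs P Q α := by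
  have hlim : Tendsto (fun α : ℝ => Real.exp (-γ) + Fintype.card 𝒳 * α ^ η)
      (nhdsWithin 0 (Set.Ioi 0)) (nhds (Real.exp (-γ))) := by
    have h2 : Tendsto (fun α : ℝ => α ^ η) (nhds 0) (nhds 0) := by
      simpa [Real.zero_rpow h0.ne'] using (Real.continuousAt_rpow_const 0 η (Or.inr h0.le)).tendsto
    simpa using (((h2.const_mul (Fintype.card 𝒳 : ℝ)).const_add (Real.exp (-γ))).mono_left
      nhdsWithin_le_nhds)
  have h3 : Real.exp (-γ) < Real.exp (-(η * γ)) := Real.exp_lt_exp.2 (by nlinarith)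
  filter_upwards [hlim.eventually_lt_const h3, self_mem_nhdsWithin] with α hα (hα0 : 0 < α)
  have hM := mixture_mem_simplex hP hQ hα0.le
  have h4 := exp_neg_klSum_le hP hM hP (fun _ h => (eq_zero_of_mixture_eq_zero hP hQ hα0 h).1)
    (fun _ h => h) η
  have h5 := chernoff_sum_le_of_abs_sub_le hM hQ hP h0.le h1.le (abs_mixture_sub_le hP hQ hα0.le)
  have h6 := Real.exp_lt_exp.1 (((h4.trans h5).trans (add_le_add_left hη _)).trans_lt hα)
  rw [klSum_self, mul_zero, add_zero, neg_lt_neg_iff, mul_lt_mul_iff_right₀ h0] at h6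
  have h7 := mul_klSum_mixture_le_gjs hP hQ hα0
  nlinarith

theorem existsUnique_gjs_eq {P Q : 𝒳 → ℝ} (hP : P ∈ stdSimplex ℝ 𝒳) (hQ : Q ∈ stdSimplex ℝ 𝒳)
    {γ η : ℝ} (hγ : 0 < γ) (h0 : 0 < η) (h1 : η < 1)
    (hη : ∑ a, Q a ^ η * P a ^ (1 - η) ≤ Real.exp (-γ)) :
    ∃! α : ℝ, 0 < α ∧ gjs P Q α = γ * α := by
  have hne : P ≠ Q := ne_of_chernoff_sum_lt_one hP (hη.trans_lt (by simpa using hγ))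
  obtain ⟨L, hL0, hL⟩ := exists_forall_gjs_lt (𝒳 := 𝒳) hγ
  obtain ⟨l, ⟨hl, hlL⟩, hl0 : 0 < l⟩ := ((eventually_lt_gjs hP hQ hγ h0 h1 hη).and
    (((eventually_lt_nhds hL0).filter_mono nhdsWithin_le_nhds))).and self_mem_nhdsWithin |>.exists
  have hc : ContinuousOn (fun α => gjs P Q α - γ * α) (Set.Icc l L) :=
    ((continuousOn_gjs hP hQ).mono fun α hα => hl0.trans_le hα.1).sub (by fun_prop)
  obtain ⟨α, hα, hα'⟩ := intermediate_value_Icc' hlL.le hc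
    (show (0 : ℝ) ∈ Set.Icc _ _ from ⟨by linarith [hL L le_rfl P hP Q hQ], by linarith⟩)
  refine ⟨α, ⟨hl0.trans_le hα.1, by linarith [show gjs P Q α - γ * α = 0 from hα']⟩, ?_⟩
  have key : ∀ x y : ℝ, 0 < x → gjs P Q x = γ * x → 0 < y → gjs P Q y = γ * y → ¬ x < y := by
    intro x y hx hx' hy hy' hxy
    have := gjs_div_lt_gjs_div hP hQ hne hx hxy
    rw [hx', hy', mul_div_cancel_right₀ _ hx.ne', mul_div_cancel_right₀ _ hy.ne'] at this
    exact this.false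
  rintro y ⟨hy, hy'⟩
  have hα0 := hl0.trans_le hα.1
  have hα1 : gjs P Q α = γ * α := by linarith [show gjs P Q α - γ * α = 0 from hα']
  exact le_antisymm (not_lt.1 (key α y hα0 hα1 hy hy')) (not_lt.1 (key y α hy hy' hα0 hα1))

theorem gjs_lt_of_root_lt {P Q : 𝒳 → ℝ} (hP : P ∈ stdSimplex ℝ 𝒳) (hQ : Q ∈ stdSimplex ℝ 𝒳)
    (hne : P ≠ Q) {γ β α : ℝ} (hβ : 0 < β) (h : gjs P Q β = γ * β) (hlt : β < α) :
    gjs P Q α < γ * α := by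
  have := gjs_div_lt_gjs_div hP hQ hne hβ hlt
  rwa [h, mul_div_cancel_right₀ _ hβ.ne', div_lt_iff₀ (hβ.trans hlt)] at this

theorem lt_gjs_of_lt_root {P Q : 𝒳 → ℝ} (hP : P ∈ stdSimplex ℝ 𝒳) (hQ : Q ∈ stdSimplex ℝ 𝒳)
    (hne : P ≠ Q) {γ β α : ℝ} (hα : 0 < α) (h : gjs P Q β = γ * β) (hlt : α < β) :
    γ * α < gjs P Q α := by
  have := gjs_div_lt_gjs_div hP hQ hne hα hlt
  rwa [h, mul_div_cancel_right₀ _ (hα.trans hlt).ne', lt_div_iff₀ hα] at this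

/-- If a training sequence of type `A` and a test sequence of type `B` and length `N ^ 2` do not
reach the threshold, then the exponent of their probability is at least that of the Chernoff
bound. -/
theorem eventually_le_klSum_of_gjs_lt {P Q : 𝒳 → ℝ} (hP : P ∈ stdSimplex ℝ 𝒳)
    (hQ : Q ∈ stdSimplex ℝ 𝒳) {γ η ε : ℝ} (hγ : 0 < γ) (hε : 0 < ε) (h0 : 0 < η) (h1 : η < 1)
    (hη : ∑ a, Q a ^ η * P a ^ (1 - η) ≤ Real.exp (-γ)) :
    ∀ᶠ N : ℕ in atTop, ∀ A ∈ stdSimplex ℝ 𝒳, ∀ B ∈ stdSimplex ℝ 𝒳,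
      (∀ a, P a = 0 → A a = 0) → (∀ a, Q a = 0 → B a = 0) →
      (N : ℝ) ^ 2 * gjs A B ((N : ℝ)⁻¹) < γ * N →
      (γ - ε) * N ≤ N * klSum A P + (N : ℝ) ^ 2 * klSum B Q := by
  have hlim : Tendsto (fun N : ℕ => Real.exp (-γ) +
      Fintype.card 𝒳 * (2 * √(γ * (N : ℝ)⁻¹) + (N : ℝ)⁻¹) ^ η) atTop (nhds (Real.exp (-γ))) := by
    have h2 : Tendsto (fun N : ℕ => (N : ℝ)⁻¹) atTop (nhds 0) := tendsto_inv_atTop_nhds_zero_nat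
    have hcont : ContinuousAt (fun t : ℝ => Real.exp (-γ) +
        Fintype.card 𝒳 * (2 * √(γ * t) + t) ^ η) 0 := by
      refine ContinuousAt.add continuousAt_const (ContinuousAt.mul continuousAt_const ?_)
      exact ContinuousAt.rpow_const (by fun_prop) (Or.inr h0.le)
    have h3 := hcont.tendsto.comp h2
    simp only [mul_zero, Real.sqrt_zero, add_zero, Real.zero_rpow h0.ne'] at h3
    exact h3
  -- The slack carries the factor 1 - η because D(A‖P) enters the variational bound with that
  -- weight.
  have h3 : Real.exp (-γ) < Real.exp (-(γ - (1 - η) * ε)) := Real.exp_lt_exp.2 (by nlinarith)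
  filter_upwards [hlim.eventually_lt_const h3, eventually_gt_atTop 0] with N hN hN0
    A hA B hB hAP hBQ hS
  have hN0 : (0 : ℝ) < N := by exact_mod_cast hN0
  have hα : 0 < (N : ℝ)⁻¹ := by positivity
  have hkA := klSum_nonneg hA hP hAP
  have hkB := klSum_nonneg hB hQ hBQ
  -- With N² test samples, a divergence of γ/N already costs γN; otherwise B lies within O(N^(-1/2))
  -- of Q, and so does the mixture.
  rcases le_or_gt (γ * (N : ℝ)⁻¹) (klSum B Q) with hB1 | hB1
  · have h4 : γ * N ≤ (N : ℝ) ^ 2 * klSum B Q := by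
      calc γ * N = (N : ℝ) ^ 2 * (γ * (N : ℝ)⁻¹) := by field_simp
        _ ≤ _ := by gcongr
    nlinarith [mul_nonneg hN0.le hkA, mul_pos hε hN0]
  have hM := mixture_mem_simplex hA hB hα.le
  have hr : ∀ a, |mixture A B (N : ℝ)⁻¹ a - Q a| ≤ 2 * √(γ * (N : ℝ)⁻¹) + (N : ℝ)⁻¹ := by
    intro a
    have h4 : |B a - Q a| ≤ 2 * √(γ * (N : ℝ)⁻¹) := by
      refine abs_le_of_sq_le_sq ?_ (by positivity)
      rw [mul_pow, Real.sq_sqrt (by positivity)]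
      linarith [sq_sub_le_klSum hB hQ hBQ a]
    have h5 := abs_mixture_sub_le hA hB hα.le a
    have h6 := abs_sub_le (mixture A B (N : ℝ)⁻¹ a) (B a) (Q a)
    linarith
  have hkM : klSum A (mixture A B (N : ℝ)⁻¹) < γ := by
    have h4 := mul_klSum_mixture_le_gjs hA hB hα
    have h5 := (mul_le_mul_of_nonneg_left h4 (sq_nonneg (N : ℝ))).trans_lt hS
    have h6 : (N : ℝ) ^ 2 * ((N : ℝ)⁻¹ * klSum A (mixture A B (N : ℝ)⁻¹)) =
        klSum A (mixture A B (N : ℝ)⁻¹) * N := by field_simp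
    rw [h6] at h5
    exact lt_of_mul_lt_mul_right h5 hN0.le
  have h4 := exp_neg_klSum_le hA hM hP (fun _ h => (eq_zero_of_mixture_eq_zero hA hB hα h).1) hAP η
  have h5 := chernoff_sum_le_of_abs_sub_le hM hQ hP h0.le h1.le hr
  have h6 := Real.exp_lt_exp.1 (((h4.trans h5).trans (add_le_add_left hη _)).trans_lt hN)
  have h7 : (1 - η) * (γ - ε) < (1 - η) * klSum A P := by nlinarith
  have h8 := lt_of_mul_lt_mul_left h7 (by linarith)
  nlinarith [mul_lt_mul_of_pos_right h8 hN0, mul_nonneg (sq_nonneg (N : ℝ)) hkB]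

theorem pmfReal_mem_simplex (P : PMF 𝒳) : pmfReal P ∈ stdSimplex ℝ 𝒳 := by
  refine ⟨fun a => ENNReal.toReal_nonneg, ?_⟩
  simp only [pmfReal]
  rw [← ENNReal.toReal_sum fun a _ => P.apply_ne_top a, ← tsum_fintype (L := .unconditional _), P.tsum_coe,
    ENNReal.toReal_one]

theorem toReal_chernoff_sum (P Q : PMF 𝒳) {η : ℝ} (h0 : 0 ≤ η) (h1 : η ≤ 1) :
    (∑ a, P a ^ η * Q a ^ (1 - η)) ≠ ⊤ ∧
    (∑ a, P a ^ η * Q a ^ (1 - η)).toReal = ∑ a, pmfReal P a ^ η * pmfReal Q a ^ (1 - η) := by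
  have h : ∀ a, P a ^ η * Q a ^ (1 - η) ≠ ⊤ := fun a =>
    ENNReal.mul_ne_top (ENNReal.rpow_ne_top_of_nonneg h0 (P.apply_ne_top a))
      (ENNReal.rpow_ne_top_of_nonneg (by linarith) (Q.apply_ne_top a))
  refine ⟨ENNReal.sum_ne_top.2 fun a _ => h a, ?_⟩
  rw [ENNReal.toReal_sum fun a _ => h a]
  refine Finset.sum_congr rfl fun a _ => ?_
  rw [ENNReal.toReal_mul, ← ENNReal.toReal_rpow, ← ENNReal.toReal_rpow, pmfReal, pmfReal]

theorem log_chernoff_sum_le_iff (P Q : PMF 𝒳) {η γ : ℝ} (h0 : 0 ≤ η) (h1 : η ≤ 1) :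
    ENNReal.log (∑ a, P a ^ η * Q a ^ (1 - η)) ≤ ((-γ : ℝ) : EReal) ↔
      ∑ a, pmfReal P a ^ η * pmfReal Q a ^ (1 - η) ≤ Real.exp (-γ) := by
  obtain ⟨h2, h3⟩ := toReal_chernoff_sum P Q h0 h1
  have h4 : ((-γ : ℝ) : EReal) = ENNReal.log (ENNReal.ofReal (Real.exp (-γ))) := by
    rw [ENNReal.log_ofReal_of_pos (Real.exp_pos _), Real.log_exp]
  rw [h4, ENNReal.log_le_log_iff, ← h3, ENNReal.le_ofReal_iff_toReal_le h2 (Real.exp_pos _).le]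

/-- An interior exponent at which the Chernoff bound reaches `γ`. -/
theorem exists_chernoff_sum_le (P Q : PMF 𝒳) {γ : ℝ} (hγ : 0 < γ)
    (hC : (γ : EReal) ≤ chernoffInfo P Q)
    (hsupp : (γ : EReal) = chernoffInfo P Q → P.support = Q.support) :
    ∃ η : ℝ, 0 < η ∧ η < 1 ∧
      ∑ a, pmfReal P a ^ η * pmfReal Q a ^ (1 - η) ≤ Real.exp (-γ) := by
  have hP := pmfReal_mem_simplex P
  have hQ := pmfReal_mem_simplex Q
  suffices h : ∃ η ∈ Set.Icc (0 : ℝ) 1,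
      ∑ a, pmfReal P a ^ η * pmfReal Q a ^ (1 - η) ≤ Real.exp (-γ) by
    obtain ⟨η, ⟨h0, h1⟩, h⟩ := h
    have hlt : Real.exp (-γ) < 1 := by simpa using hγ
    -- At the endpoints the sum is 1 (with 0^0 = 1), which exceeds exp(-γ).
    refine ⟨η, lt_of_le_of_ne h0 ?_, lt_of_le_of_ne h1 ?_, h⟩
    · rintro rfl
      simp [hQ.2] at h
      linarith
    · rintro rfl
      simp [hP.2] at h
      linarith
  rcases hC.lt_or_eq with hlt | heq
  · have h1 : (⨅ η ∈ Set.Icc (0 : ℝ) 1, ENNReal.log (∑ a, P a ^ η * Q a ^ (1 - η))) <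
        ((-γ : ℝ) : EReal) := by
      rw [EReal.coe_neg, ← EReal.lt_neg_comm]
      exact hlt
    simp only [iInf_lt_iff] at h1
    obtain ⟨η, hη, h⟩ := h1
    exact ⟨η, hη, (log_chernoff_sum_le_iff P Q hη.1 hη.2).1 h.le⟩
  · have hs := hsupp heq
    -- Equal supports rule out jumps at the endpoints caused by 0^0 = 1, so the infimum is attained.
    have hcont : Continuous fun η : ℝ => ∑ a, pmfReal P a ^ η * pmfReal Q a ^ (1 - η) := by
      refine continuous_finsetSum _ fun a _ => ?_
      have h0 : pmfReal P a = 0 ↔ pmfReal Q a = 0 := by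
        have h1 : P a = 0 ↔ Q a = 0 := by
          rw [PMF.apply_eq_zero_iff, PMF.apply_eq_zero_iff, hs]
        simp [pmfReal, ENNReal.toReal_eq_zero_iff, P.apply_ne_top, Q.apply_ne_top, h1]
      by_cases hp : pmfReal P a = 0
      · have : (fun η : ℝ => pmfReal P a ^ η * pmfReal Q a ^ (1 - η)) = fun _ => 0 := by
          ext η
          rw [hp, h0.1 hp, mul_eq_zero]
          by_cases hη : η = 0
          · simp [hη]
          · exact Or.inl (Real.zero_rpow hη)
        rw [this]
        exact continuous_const
      · exact (Real.continuous_const_rpow hp).mul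
          ((Real.continuous_const_rpow (mt h0.2 hp)).comp (by fun_prop))
    obtain ⟨η, hη, hmin⟩ := isCompact_Icc.exists_isMinOn
      (Set.nonempty_Icc.2 (zero_le_one' ℝ)) hcont.continuousOn
    refine ⟨η, hη, (log_chernoff_sum_le_iff P Q hη.1 hη.2).1 ?_⟩
    rw [EReal.coe_neg, heq, chernoffInfo, neg_neg]
    refine le_iInf₂ fun ξ hξ => ENNReal.log_le_log ?_
    obtain ⟨h1, h2⟩ := toReal_chernoff_sum P Q hη.1 hη.2
    obtain ⟨h3, h4⟩ := toReal_chernoff_sum P Q hξ.1 hξ.2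
    rw [← ENNReal.toReal_le_toReal h1 h3, h2, h4]
    exact hmin hξ

end Chernoff

/-! ### The method of types. -/

section Types

variable {𝒳 : Type*} [Fintype 𝒳]

theorem sum_comp_eq_empDist {n : ℕ} (hn : 0 < n) (x : Fin n → 𝒳) (f : 𝒳 → ℝ) :
    ∑ i, f (x i) = n * ∑ a, empDist x a * f a := by
  classical
  have hn' : (n : ℝ) ≠ 0 := by positivity
  have h : ∀ a, (n : ℝ) * (empDist x a * f a) = ∑ i, if x i = a then f a else 0 := fun a => by
    rw [empDist, ← mul_assoc, ← mul_assoc, mul_one_div_cancel hn', one_mul, Finset.sum_mul]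
    exact Finset.sum_congr rfl fun i _ => by split_ifs <;> simp
  simp_rw [Finset.mul_sum, h]
  rw [Finset.sum_comm]
  simp

theorem empDist_mem_simplex {n : ℕ} (hn : 0 < n) (x : Fin n → 𝒳) :
    empDist x ∈ stdSimplex ℝ 𝒳 := by
  have hn' : (0 : ℝ) < n := by positivity
  refine ⟨fun a => ?_, ?_⟩
  · unfold empDist
    exact mul_nonneg (by positivity) (Finset.sum_nonneg fun i _ => by split_ifs <;> simp)
  · have h := sum_comp_eq_empDist hn x fun _ => 1
    simp only [Finset.sum_const, Finset.card_univ, Fintype.card_fin, nsmul_eq_mul, mul_one] at h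
    exact (mul_eq_left₀ hn'.ne').1 h.symm

theorem empDist_pos {𝒳 : Type*} {n : ℕ} (x : Fin n → 𝒳) (i : Fin n) : 0 < empDist x (x i) := by
  have hn : (0 : ℝ) < n := by exact_mod_cast i.pos
  unfold empDist
  refine mul_pos (by positivity) (Finset.sum_pos' (fun j _ => by split_ifs <;> simp)
    ⟨i, Finset.mem_univ i, by simp⟩)

theorem empDist_eq_zero {𝒳 : Type*} {n : ℕ} {x : Fin n → 𝒳} {P : 𝒳 → ℝ} (hx : ∀ i, 0 < P (x i)) (a : 𝒳)
    (ha : P a = 0) : empDist x a = 0 := by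
  unfold empDist
  rw [Finset.sum_eq_zero, mul_zero]
  intro i _
  rw [if_neg]
  rintro rfl
  exact (hx i).ne' ha

theorem prod_eq_prod_empDist_mul_exp {n : ℕ} (hn : 0 < n) {x : Fin n → 𝒳} {P : 𝒳 → ℝ}
    (hx : ∀ i, 0 < P (x i)) :
    ∏ i, P (x i) = (∏ i, empDist x (x i)) * Real.exp (-(n * klSum (empDist x) P)) := by
  have h : (n : ℝ) * klSum (empDist x) P = ∑ i, Real.log (empDist x (x i) / P (x i)) :=
    (sum_comp_eq_empDist hn x fun a => Real.log (empDist x a / P a)).symm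
  rw [h, ← Finset.sum_neg_distrib, Real.exp_sum, ← Finset.prod_mul_distrib]
  refine Finset.prod_congr rfl fun i _ => ?_
  have h1 := empDist_pos x i
  have h2 := hx i
  rw [Real.exp_neg, Real.exp_log (by positivity)]
  field_simp

/-- Sequences of a common type t contribute at most the total mass 1 of the product law of t, and
the letter counts `c` take at most (n+1)^|𝒳| values. -/
theorem sum_prod_empDist_le {n : ℕ} (hn : 0 < n) :
    ∑ x : Fin n → 𝒳, ∏ i, empDist x (x i) ≤ ((n : ℝ) + 1) ^ Fintype.card 𝒳 := by
  classical
  let c : (Fin n → 𝒳) → 𝒳 → Fin (n + 1) := fun x a =>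
    ⟨(Finset.univ.filter fun i => x i = a).card,
      Nat.lt_succ_of_le ((Finset.card_le_univ _).trans (by simp))⟩
  have hc : ∀ x y, c x = c y → empDist x = empDist y := by
    intro x y h
    ext a
    have h1 : ∀ z : Fin n → 𝒳, empDist z a = 1 / (n : ℝ) * (c z a : ℕ) := fun z => by
      simp [empDist, c]
    rw [h1, h1, h]
  rw [← Finset.sum_fiberwise Finset.univ c]
  have h2 : ∀ t : 𝒳 → Fin (n + 1),
      ∑ x with c x = t, ∏ i, empDist x (x i) ≤ 1 := by
    intro t
    rcases (Finset.univ.filter fun x => c x = t).eq_empty_or_nonempty with h | ⟨x₀, hx₀⟩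
    · rw [h]
      simp
    have hx₀ : c x₀ = t := by simpa using hx₀
    have hA := empDist_mem_simplex hn x₀
    calc ∑ x with c x = t, ∏ i, empDist x (x i)
        = ∑ x with c x = t, ∏ i, empDist x₀ (x i) := by
          refine Finset.sum_congr rfl fun x hx => ?_
          rw [hc x x₀ (by rw [hx₀]; simpa using hx)]
      _ ≤ ∑ x : Fin n → 𝒳, ∏ i, empDist x₀ (x i) :=
          Finset.sum_le_sum_of_subset_of_nonneg (Finset.filter_subset _ _)
            fun x _ _ => Finset.prod_nonneg fun i _ => hA.1 _
      _ = 1 := by rw [← Fintype.sum_pow, hA.2, one_pow]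
  calc _ ≤ ∑ _t : 𝒳 → Fin (n + 1), (1 : ℝ) := Finset.sum_le_sum fun t _ => h2 t
    _ = _ := by simp

/-- The method of types for a pair of independent i.i.d. sequences. -/
theorem measureReal_pair_le {Ω : Type*} [MeasurableSpace Ω] {μ : Measure Ω} [IsFiniteMeasure μ]
    {N n : ℕ} (hN : 0 < N) (hn : 0 < n) {P Q : 𝒳 → ℝ} (hP : ∀ a, 0 ≤ P a) (hQ : ∀ a, 0 ≤ Q a)
    {X : Ω → Fin N → 𝒳} {V : Ω → Fin n → 𝒳}
    (hXV : ∀ x v, μ.real {ω | X ω = x ∧ V ω = v} ≤ (∏ i, P (x i)) * ∏ i, Q (v i))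
    (E : (Fin N → 𝒳) → (Fin n → 𝒳) → Prop) {R : ℝ}
    (hE : ∀ x v, (∀ i, 0 < P (x i)) → (∀ i, 0 < Q (v i)) → E x v →
      R ≤ N * klSum (empDist x) P + n * klSum (empDist v) Q) :
    μ.real {ω | E (X ω) (V ω)} ≤
      (((N : ℝ) + 1) * (n + 1)) ^ Fintype.card 𝒳 * Real.exp (-R) := by
  classical
  let S : Finset ((Fin N → 𝒳) × (Fin n → 𝒳)) := Finset.univ.filter fun p => E p.1 p.2
  have hsub : {ω | E (X ω) (V ω)} ⊆ ⋃ p ∈ S, {ω | X ω = p.1 ∧ V ω = p.2} := by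
    intro ω hω
    simp only [Set.mem_iUnion]
    exact ⟨(X ω, V ω), by simpa [S] using hω, rfl, rfl⟩
  have hw : ∀ x : Fin N → 𝒳, 0 ≤ ∏ i, empDist x (x i) :=
    fun x => Finset.prod_nonneg fun i _ => (empDist_pos x i).le
  have hw' : ∀ x : Fin n → 𝒳, 0 ≤ ∏ i, empDist x (x i) :=
    fun x => Finset.prod_nonneg fun i _ => (empDist_pos x i).le
  have hterm : ∀ p ∈ S, μ.real {ω | X ω = p.1 ∧ V ω = p.2} ≤
      ((∏ i, empDist p.1 (p.1 i)) * ∏ i, empDist p.2 (p.2 i)) * Real.exp (-R) := by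
    rintro ⟨x, v⟩ hp
    have hp : E x v := by simpa [S] using hp
    refine (hXV x v).trans ?_
    have hnn : 0 ≤ ((∏ i, empDist x (x i)) * ∏ i, empDist v (v i)) * Real.exp (-R) :=
      mul_nonneg (mul_nonneg (hw x) (hw' v)) (Real.exp_pos _).le
    -- A letter of mass zero makes the probability vanish, so the exponent matters only for
    -- sequences inside the supports.
    by_cases hx : ∀ i, 0 < P (x i)
    · by_cases hv : ∀ i, 0 < Q (v i)
      · rw [prod_eq_prod_empDist_mul_exp hN hx, prod_eq_prod_empDist_mul_exp hn hv,
          mul_mul_mul_comm, ← Real.exp_add]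
        refine mul_le_mul_of_nonneg_left (Real.exp_le_exp.2 ?_) (mul_nonneg (hw x) (hw' v))
        linarith [hE x v hx hv hp]
      · push Not at hv
        obtain ⟨i, hi⟩ := hv
        rw [Finset.prod_eq_zero (f := fun i => Q (v i)) (Finset.mem_univ i)
          (le_antisymm hi (hQ _)), mul_zero]
        exact hnn
    · push Not at hx
      obtain ⟨i, hi⟩ := hx
      rw [Finset.prod_eq_zero (f := fun i => P (x i)) (Finset.mem_univ i)
        (le_antisymm hi (hP _)), zero_mul]
      exact hnn
  calc μ.real {ω | E (X ω) (V ω)}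
      ≤ μ.real (⋃ p ∈ S, {ω | X ω = p.1 ∧ V ω = p.2}) := measureReal_mono hsub (measure_ne_top _ _)
    _ ≤ ∑ p ∈ S, μ.real {ω | X ω = p.1 ∧ V ω = p.2} := measureReal_biUnion_finset_le _ _
    _ ≤ ∑ p ∈ S, ((∏ i, empDist p.1 (p.1 i)) * ∏ i, empDist p.2 (p.2 i)) * Real.exp (-R) :=
        Finset.sum_le_sum hterm
    _ ≤ ∑ p : (Fin N → 𝒳) × (Fin n → 𝒳),
          ((∏ i, empDist p.1 (p.1 i)) * ∏ i, empDist p.2 (p.2 i)) * Real.exp (-R) :=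
        Finset.sum_le_sum_of_subset_of_nonneg (Finset.filter_subset _ _)
          fun p _ _ => mul_nonneg (mul_nonneg (hw _) (hw' _)) (Real.exp_pos _).le
    _ = (∑ x : Fin N → 𝒳, ∏ i, empDist x (x i)) * (∑ v : Fin n → 𝒳, ∏ i, empDist v (v i)) *
          Real.exp (-R) := by
        rw [← Finset.sum_mul, Finset.sum_mul_sum, Fintype.sum_prod_type]
    _ ≤ _ := by
        rw [mul_pow]
        gcongr
        · exact Finset.sum_nonneg fun v _ => hw' v
        · exact sum_prod_empDist_le hN
        · exact sum_prod_empDist_le hn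

end Types

/-! ### Pathwise properties of the stopping time. -/

section StopTime

variable {𝒳 : Type*} [Fintype 𝒳]

theorem stopTime_congr {γ : ℝ} {N : ℕ} {x₁ x₂ : Fin N → 𝒳} {y y' : ℕ → 𝒳}
    (h : ∀ k < N ^ 2, y k = y' k) : stopTime γ x₁ x₂ y = stopTime γ x₁ x₂ y' := by
  have hs : ∀ (x : Fin N → 𝒳) (n : ℕ), n ≤ N ^ 2 → score x y n = score x y' n := by
    intro x n hn
    have : firstSamples y n = firstSamples y' n := by
      ext k
      exact h k (k.2.trans_le hn)
    rw [score, score, this]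
  have key : ∀ y₁ y₂ : ℕ → 𝒳, (∀ (x : Fin N → 𝒳) (n : ℕ), n ≤ N ^ 2 → score x y₁ n = score x y₂ n) →
      stopTime γ x₁ x₂ y₂ ≤ stopTime γ x₁ x₂ y₁ := by
    intro y₁ y₂ hs
    have hne : (insert (N ^ 2) {n : ℕ | 1 ≤ n ∧
        (γ * N ≤ score x₁ y₁ n ∨ γ * N ≤ score x₂ y₁ n)}).Nonempty := Set.insert_nonempty _ _
    have hle : stopTime γ x₁ x₂ y₁ ≤ N ^ 2 := Nat.sInf_le (Set.mem_insert _ _)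
    refine Nat.sInf_le ?_
    rcases Nat.sInf_mem hne with h | h
    · exact Or.inl h
    · refine Or.inr ⟨h.1, ?_⟩
      have h2 := h.2
      change γ * N ≤ score x₁ y₁ (stopTime γ x₁ x₂ y₁) ∨
        γ * N ≤ score x₂ y₁ (stopTime γ x₁ x₂ y₁) at h2
      rwa [hs _ _ hle, hs _ _ hle] at h2
  exact le_antisymm (key y' y fun x n hn => (hs x n hn).symm) (key y y' hs)

theorem stopTime_le {γ : ℝ} {N : ℕ} (x₁ x₂ : Fin N → 𝒳) (y : ℕ → 𝒳) :
    stopTime γ x₁ x₂ y ≤ N ^ 2 := Nat.sInf_le (Set.mem_insert _ _)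

theorem stopTime_le_of_le_score {γ : ℝ} {N n : ℕ} {x₁ x₂ : Fin N → 𝒳} {y : ℕ → 𝒳} (hn : 1 ≤ n)
    (h : γ * N ≤ score x₂ y n) : stopTime γ x₁ x₂ y ≤ n :=
  Nat.sInf_le (Or.inr ⟨hn, Or.inr h⟩)

theorem stopTime_eq_or (γ : ℝ) {N : ℕ} (x₁ x₂ : Fin N → 𝒳) (y : ℕ → 𝒳) :
    stopTime γ x₁ x₂ y = N ^ 2 ∨ (1 ≤ stopTime γ x₁ x₂ y ∧
      (γ * N ≤ score x₁ y (stopTime γ x₁ x₂ y) ∨ γ * N ≤ score x₂ y (stopTime γ x₁ x₂ y))) :=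
  Nat.sInf_mem (Set.insert_nonempty (N ^ 2) {n : ℕ | 1 ≤ n ∧
    (γ * N ≤ score x₁ y n ∨ γ * N ≤ score x₂ y n)})

end StopTime

/-! ### Cylinder probabilities and measurability. -/

section Law

variable {𝒳 : Type*} [MeasurableSpace 𝒳] [MeasurableSingletonClass 𝒳]

instance isProbabilityMeasure_law (P₁ P₂ : PMF 𝒳) (N : ℕ) (h : Hypothesis) :
    IsProbabilityMeasure (law P₁ P₂ N h) := by
  unfold law
  infer_instance

theorem pi_real_singleton (P : PMF 𝒳) {N : ℕ} (x : Fin N → 𝒳) :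
    (Measure.pi fun _ : Fin N => P.toMeasure).real {x} = ∏ i, pmfReal P (x i) := by
  rw [Measure.real, Measure.pi_singleton, ENNReal.toReal_prod]
  refine Finset.prod_congr rfl fun i _ => ?_
  rw [PMF.toMeasure_apply_singleton _ _ (measurableSet_singleton _), pmfReal]

theorem infinitePi_real_firstSamples (P : PMF 𝒳) {n : ℕ} (v : Fin n → 𝒳) :
    (Measure.infinitePi fun _ : ℕ => P.toMeasure).real {y | firstSamples y n = v} =
      ∏ i, pmfReal P (v i) := by
  have h : {y : ℕ → 𝒳 | firstSamples y n = v} =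
      (↑(Finset.range n) : Set ℕ).pi fun k => if hk : k < n then {v ⟨k, hk⟩} else Set.univ := by
    ext y
    simp only [Set.mem_ofPred_eq, Set.mem_pi, Finset.coe_range, Set.mem_Iio]
    constructor
    · rintro rfl k hk
      simp [hk, firstSamples]
    · intro h
      ext k
      have := h k k.2
      simpa [k.2, firstSamples] using this
  rw [Measure.real, h, Measure.infinitePi_pi _ fun k hk => by split_ifs <;> simp,
    ENNReal.toReal_prod, Finset.prod_range]
  refine Finset.prod_congr rfl fun i _ => ?_
  rw [dif_pos i.2, PMF.toMeasure_apply_singleton _ _ (measurableSet_singleton _), pmfReal]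

theorem law_real_fst (P₁ P₂ : PMF 𝒳) {N n : ℕ} (x : Fin N → 𝒳) (v : Fin n → 𝒳) :
    (law P₁ P₂ N Hypothesis.H₁).real {ω | ω.1 = x ∧ firstSamples ω.2.2 n = v} =
      (∏ i, pmfReal P₁ (x i)) * ∏ i, pmfReal P₁ (v i) := by
  have h : {ω : (Fin N → 𝒳) × (Fin N → 𝒳) × (ℕ → 𝒳) | ω.1 = x ∧ firstSamples ω.2.2 n = v} =
      {x} ×ˢ (Set.univ ×ˢ {y | firstSamples y n = v}) := by
    ext ω
    simp
  rw [h, law, measureReal_prod_prod, measureReal_prod_prod, pi_real_singleton,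
    probReal_univ, one_mul, testDist, infinitePi_real_firstSamples]

theorem law_real_snd (P₁ P₂ : PMF 𝒳) {N n : ℕ} (x : Fin N → 𝒳) (v : Fin n → 𝒳) :
    (law P₁ P₂ N Hypothesis.H₁).real {ω | ω.2.1 = x ∧ firstSamples ω.2.2 n = v} =
      (∏ i, pmfReal P₂ (x i)) * ∏ i, pmfReal P₁ (v i) := by
  have h : {ω : (Fin N → 𝒳) × (Fin N → 𝒳) × (ℕ → 𝒳) | ω.2.1 = x ∧ firstSamples ω.2.2 n = v} =
      Set.univ ×ˢ ({x} ×ˢ {y | firstSamples y n = v}) := by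
    ext ω
    simp
  rw [h, law, measureReal_prod_prod, measureReal_prod_prod, pi_real_singleton,
    probReal_univ, one_mul, testDist, infinitePi_real_firstSamples]

/-- The stopping time factors through the first N² test samples, hence through a finite space; the
letter `a` pads the rest of the sequence. -/
theorem measurable_stopTime [Fintype 𝒳] (γ : ℝ) (N : ℕ) :
    Measurable fun ω : (Fin N → 𝒳) × (Fin N → 𝒳) × (ℕ → 𝒳) => stopTime γ ω.1 ω.2.1 ω.2.2 := by
  rcases isEmpty_or_nonempty 𝒳 with hX | ⟨⟨a⟩⟩
  · have : IsEmpty ((Fin N → 𝒳) × (Fin N → 𝒳) × (ℕ → 𝒳)) := ⟨fun ω => hX.elim (ω.2.2 0)⟩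
    exact measurable_of_empty _
  let g : (Fin N → 𝒳) × (Fin N → 𝒳) × (Fin (N ^ 2) → 𝒳) → ℕ := fun z =>
    stopTime γ z.1 z.2.1 fun k => if hk : k < N ^ 2 then z.2.2 ⟨k, hk⟩ else a
  have h : (fun ω : (Fin N → 𝒳) × (Fin N → 𝒳) × (ℕ → 𝒳) => stopTime γ ω.1 ω.2.1 ω.2.2) =
      g ∘ fun ω => (ω.1, ω.2.1, firstSamples ω.2.2 (N ^ 2)) := by
    ext ω
    exact stopTime_congr fun k hk => by simp [hk, firstSamples]
  rw [h]
  refine (measurable_of_finite g).comp ?_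
  unfold firstSamples
  fun_prop

end Law

/-! ### Polynomial factors and the union bound over times. -/

section Asymptotics

theorem eventually_mul_pow_le_exp (K : ℝ) (m : ℕ) {ε : ℝ} (hε : 0 < ε) :
    ∀ᶠ N : ℕ in atTop, K * ((N : ℝ) + 1) ^ m ≤ Real.exp (ε * N) := by
  have h := (isLittleO_pow_exp_pos_mul_atTop m hε).const_mul_left K
  have h1 : Tendsto (fun N : ℕ => (N : ℝ) + 1) atTop atTop :=
    tendsto_atTop_add_const_right _ _ tendsto_natCast_atTop_atTop
  -- The constant exp(-ε) absorbs the shift from N to N + 1.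
  filter_upwards [(h.comp_tendsto h1).bound (Real.exp_pos (-ε))] with N hN
  simp only [Function.comp_apply, Real.norm_eq_abs, Real.abs_exp] at hN
  rw [← Real.exp_add] at hN
  refine (le_abs_self _).trans (hN.trans_eq (congrArg Real.exp ?_))
  ring

theorem types_card_le {N n k : ℕ} (hn : n ≤ N ^ 2) :
    (((N : ℝ) + 1) * (n + 1)) ^ k ≤ ((N : ℝ) + 1) ^ (3 * k) := by
  rw [pow_mul]
  have : (n : ℝ) ≤ (N : ℝ) ^ 2 := by exact_mod_cast hn
  gcongr
  nlinarith [Nat.cast_nonneg (α := ℝ) N, sq_nonneg ((N : ℝ))]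

theorem measureReal_exists_le {Ω : Type*} [MeasurableSpace Ω] (μ : Measure Ω) [IsFiniteMeasure μ]
    (E : ℕ → Ω → Prop) (M : ℕ) {b : ℝ} (h : ∀ n, 1 ≤ n → n ≤ M → μ.real {ω | E n ω} ≤ b) :
    μ.real {ω | ∃ n, 1 ≤ n ∧ n ≤ M ∧ E n ω} ≤ M * b := by
  have hsub : {ω | ∃ n, 1 ≤ n ∧ n ≤ M ∧ E n ω} ⊆ ⋃ n ∈ Finset.Icc 1 M, {ω | E n ω} := by
    rintro ω ⟨n, h1, h2, h3⟩
    simp only [Set.mem_iUnion, Finset.mem_Icc]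
    exact ⟨n, ⟨h1, h2⟩, h3⟩
  calc _ ≤ _ := measureReal_mono hsub (measure_ne_top _ _)
    _ ≤ ∑ n ∈ Finset.Icc 1 M, μ.real {ω | E n ω} := measureReal_biUnion_finset_le _ _
    _ ≤ ∑ n ∈ Finset.Icc 1 M, b :=
        Finset.sum_le_sum fun n hn => h n (Finset.mem_Icc.1 hn).1 (Finset.mem_Icc.1 hn).2
    _ = M * b := by simp

end Asymptotics

/-! ### Error exponents under H₁. -/

section Errors

variable {𝒳 : Type*} [Fintype 𝒳] [MeasurableSpace 𝒳] [MeasurableSingletonClass 𝒳]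

/-- P₁ generates both sequences, so it is a competitor R in the minimum, and the score is at most
the exponent of the pair of types. -/
theorem law_real_le_score_fst (P₁ P₂ : PMF 𝒳) {γ : ℝ} {N n : ℕ} (hN : 0 < N) (hn : 0 < n) :
    (law P₁ P₂ N Hypothesis.H₁).real {ω | γ * N ≤ score ω.1 ω.2.2 n} ≤
      (((N : ℝ) + 1) * (n + 1)) ^ Fintype.card 𝒳 * Real.exp (-(γ * N)) := by
  have hP := pmfReal_mem_simplex P₁
  refine measureReal_pair_le hN hn hP.1 hP.1 (fun x v => (law_real_fst P₁ P₂ x v).le)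
    (fun x v => γ * N ≤ n * gjs (empDist x) (empDist v) ((N : ℝ) / n)) fun x v hx hv hE => ?_
  have hn' : (0 : ℝ) < n := by positivity
  have h := gjs_le_klSum_add_klSum (empDist_mem_simplex hN x) (empDist_mem_simplex hn v) hP
    (α := (N : ℝ) / n) (by positivity) (empDist_eq_zero hx) (empDist_eq_zero hv)
  refine hE.trans ((mul_le_mul_of_nonneg_left h hn'.le).trans_eq ?_)
  field_simp

theorem law_real_exists_le_score_fst (P₁ P₂ : PMF 𝒳) {γ : ℝ} {N : ℕ} (hN : 0 < N) :
    (law P₁ P₂ N Hypothesis.H₁).real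
      {ω | ∃ n, 1 ≤ n ∧ n ≤ N ^ 2 ∧ γ * N ≤ score ω.1 ω.2.2 n} ≤
      (N : ℝ) ^ 2 * (((N : ℝ) + 1) ^ (3 * Fintype.card 𝒳) * Real.exp (-(γ * N))) := by
  have h := measureReal_exists_le (law P₁ P₂ N Hypothesis.H₁)
    (fun n ω => γ * N ≤ score ω.1 ω.2.2 n) (N ^ 2) fun n h1 h2 =>
      (law_real_le_score_fst P₁ P₂ (γ := γ) hN h1).trans
        (mul_le_mul_of_nonneg_right (types_card_le h2) (Real.exp_pos _).le)
  exact_mod_cast h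

theorem eventually_law_real_score_snd_lt (P₁ P₂ : PMF 𝒳) {γ η ε : ℝ} (hγ : 0 < γ) (hε : 0 < ε)
    (h0 : 0 < η) (h1 : η < 1)
    (hη : ∑ a, pmfReal P₁ a ^ η * pmfReal P₂ a ^ (1 - η) ≤ Real.exp (-γ)) :
    ∀ᶠ N : ℕ in atTop, (law P₁ P₂ N Hypothesis.H₁).real
      {ω | score ω.2.1 ω.2.2 (N ^ 2) < γ * N} ≤
      ((N : ℝ) + 1) ^ (3 * Fintype.card 𝒳) * Real.exp (-((γ - ε) * N)) := by
  have hP := pmfReal_mem_simplex P₁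
  have hQ := pmfReal_mem_simplex P₂
  filter_upwards [eventually_le_klSum_of_gjs_lt hQ hP hγ hε h0 h1 hη, eventually_gt_atTop 0]
    with N hN hN0
  have hN2 : 0 < N ^ 2 := by positivity
  refine (measureReal_pair_le hN0 hN2 hQ.1 hP.1 (fun x v => (law_real_snd P₁ P₂ x v).le) (fun x v =>
    (N ^ 2 : ℕ) * gjs (empDist x) (empDist v) ((N : ℝ) / (N ^ 2 : ℕ)) < γ * N)
    fun x v hx hv hE => ?_).trans
    (mul_le_mul_of_nonneg_right (types_card_le le_rfl) (Real.exp_pos _).le)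
  have hα : (N : ℝ) / (N ^ 2 : ℕ) = (N : ℝ)⁻¹ := by
    push_cast
    field_simp
  rw [hα] at hE
  push_cast at hE ⊢
  exact hN _ (empDist_mem_simplex hN0 x) _ (empDist_mem_simplex hN2 v) (empDist_eq_zero hx)
    (empDist_eq_zero hv) hE

theorem expLE_errProb (P₁ P₂ : PMF 𝒳) {γ η : ℝ} (hγ : 0 < γ) (h0 : 0 < η) (h1 : η < 1)
    (hη : ∑ a, pmfReal P₁ a ^ η * pmfReal P₂ a ^ (1 - η) ≤ Real.exp (-γ))
    {d : (N : ℕ) → (Fin N → 𝒳) → (Fin N → 𝒳) → (ℕ → 𝒳) → Hypothesis}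
    (hd : ∀ (N : ℕ) (x₁ x₂ : Fin N → 𝒳) (y : ℕ → 𝒳), γ * N ≤ score x₂ y (stopTime γ x₁ x₂ y) →
      ¬ γ * N ≤ score x₁ y (stopTime γ x₁ x₂ y) → d N x₁ x₂ y = Hypothesis.H₁) :
    ExpLE (fun N => errProb P₁ P₂ N (d N) Hypothesis.H₁) (fun N => Real.exp (-(N * γ))) := by
  intro ε hε
  filter_upwards [eventually_law_real_score_snd_lt P₁ P₂ hγ (half_pos hε) h0 h1 hη,
    eventually_mul_pow_le_exp 1 (3 * Fintype.card 𝒳 + 2) (half_pos hε), eventually_gt_atTop 0]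
    with N hN hpoly hN0
  -- If S₁ stays below γN and S₂(N²) ≥ γN, then S₂ is at least γN at the stop, whether this is a
  -- crossing or the cutoff N², and the rule declares H₁.
  have hsub : {ω : (Fin N → 𝒳) × (Fin N → 𝒳) × (ℕ → 𝒳) | d N ω.1 ω.2.1 ω.2.2 ≠ Hypothesis.H₁} ⊆
      {ω | ∃ n, 1 ≤ n ∧ n ≤ N ^ 2 ∧ γ * N ≤ score ω.1 ω.2.2 n} ∪
        {ω | score ω.2.1 ω.2.2 (N ^ 2) < γ * N} := by
    rintro ⟨x₁, x₂, y⟩ hω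
    by_cases hS : ∃ n, 1 ≤ n ∧ n ≤ N ^ 2 ∧ γ * N ≤ score x₁ y n
    · exact Or.inl hS
    refine Or.inr (show score x₂ y (N ^ 2) < γ * N from lt_of_not_ge fun h2 => hω ?_)
    push Not at hS
    have hT : 1 ≤ stopTime γ x₁ x₂ y ∧ γ * N ≤ score x₂ y (stopTime γ x₁ x₂ y) := by
      rcases stopTime_eq_or γ x₁ x₂ y with h | ⟨h, h' | h'⟩
      · rw [h]
        exact ⟨Nat.pow_pos hN0, h2⟩
      · exact absurd h' (hS _ h (stopTime_le _ _ _)).not_ge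
      · exact ⟨h, h'⟩
    exact hd N x₁ x₂ y hT.2 (hS _ hT.1 (stopTime_le _ _ _)).not_ge
  have herr : errProb P₁ P₂ N (d N) Hypothesis.H₁ ≤
      (N : ℝ) ^ 2 * (((N : ℝ) + 1) ^ (3 * Fintype.card 𝒳) * Real.exp (-(γ * N))) +
        ((N : ℝ) + 1) ^ (3 * Fintype.card 𝒳) * Real.exp (-((γ - ε / 2) * N)) :=
    (measureReal_mono hsub (measure_ne_top _ _)).trans ((measureReal_union_le _ _).trans
      (add_le_add (law_real_exists_le_score_fst P₁ P₂ hN0) hN))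
  have hexp : Real.exp (-(γ * N)) ≤ Real.exp (-((γ - ε / 2) * N)) :=
    Real.exp_le_exp.2 (by nlinarith [Nat.cast_nonneg (α := ℝ) N])
  rw [div_le_iff₀ (Real.exp_pos _)]
  calc errProb P₁ P₂ N (d N) Hypothesis.H₁
      ≤ (N : ℝ) ^ 2 * (((N : ℝ) + 1) ^ (3 * Fintype.card 𝒳) * Real.exp (-((γ - ε / 2) * N))) +
        ((N : ℝ) + 1) ^ (3 * Fintype.card 𝒳) * Real.exp (-((γ - ε / 2) * N)) :=
        herr.trans (by gcongr)
    _ = ((N : ℝ) ^ 2 + 1) * ((N : ℝ) + 1) ^ (3 * Fintype.card 𝒳) *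
        Real.exp (-((γ - ε / 2) * N)) := by ring
    _ ≤ Real.exp (ε / 2 * N) * Real.exp (-((γ - ε / 2) * N)) := by
        refine mul_le_mul_of_nonneg_right (le_trans ?_ hpoly) (Real.exp_pos _).le
        rw [one_mul, pow_add, mul_comm]
        gcongr
        nlinarith [Nat.cast_nonneg (α := ℝ) N]
    _ = Real.exp (ε * N) * Real.exp (-(N * γ)) := by
        rw [← Real.exp_add, ← Real.exp_add]
        congr 1
        ring

end Errors

/-! ### Concentration and mean of the stopping time under H₁. -/

section StoppingTime

variable {𝒳 : Type*} [Fintype 𝒳] [MeasurableSpace 𝒳] [MeasurableSingletonClass 𝒳]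

theorem law_real_types_far (P₁ P₂ : PMF 𝒳) {κ δ : ℝ} (hδ1 : δ ≤ 1) {N n : ℕ}
    (hN : 0 < N) (hn : 0 < n) (hδn : δ * N ≤ n) (hκ : 0 < κ) :
    (law P₁ P₂ N Hypothesis.H₁).real
      {ω | ¬ ∀ a, |empDist ω.2.1 a - pmfReal P₂ a| < κ ∧
        |empDist (firstSamples ω.2.2 n) a - pmfReal P₁ a| < κ} ≤
      (((N : ℝ) + 1) * (n + 1)) ^ Fintype.card 𝒳 * Real.exp (-(κ ^ 2 / 4 * δ * N)) := by
  have hP := pmfReal_mem_simplex P₁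
  have hQ := pmfReal_mem_simplex P₂
  refine measureReal_pair_le hN hn hQ.1 hP.1 (fun x v => (law_real_snd P₁ P₂ x v).le)
    (fun x v => ¬ ∀ a, |empDist x a - pmfReal P₂ a| < κ ∧ |empDist v a - pmfReal P₁ a| < κ)
    fun x v hx hv hE => ?_
  have hA := empDist_mem_simplex hN x
  have hB := empDist_mem_simplex hn v
  have hkA := klSum_nonneg hA hQ (empDist_eq_zero hx)
  have hkB := klSum_nonneg hB hP (empDist_eq_zero hv)
  have hN' : (0 : ℝ) < N := by positivity
  have hn' : (0 : ℝ) < n := by positivity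
  have hc : 0 ≤ κ ^ 2 / 4 := by positivity
  push Not at hE
  obtain ⟨a, ha⟩ := hE
  by_cases h : |empDist x a - pmfReal P₂ a| < κ
  · have h1 : κ ^ 2 ≤ (empDist v a - pmfReal P₁ a) ^ 2 := by
      rw [← sq_abs (empDist v a - pmfReal P₁ a)]
      exact pow_le_pow_left₀ hκ.le (ha h) 2
    have h2 := h1.trans (sq_sub_le_klSum hB hP (empDist_eq_zero hv) a)
    nlinarith [mul_nonneg hN'.le hkA, mul_le_mul_of_nonneg_left hδn hc]
  · have h1 : κ ^ 2 ≤ (empDist x a - pmfReal P₂ a) ^ 2 := by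
      rw [← sq_abs (empDist x a - pmfReal P₂ a)]
      exact pow_le_pow_left₀ hκ.le (not_lt.1 h) 2
    have h2 := h1.trans (sq_sub_le_klSum hA hQ (empDist_eq_zero hx) a)
    have h3 : δ * N ≤ N := by nlinarith
    nlinarith [mul_nonneg hn'.le hkB, mul_le_mul_of_nonneg_left h3 hc]

/-- Outside an event of probability `O(N⁻²)` the true score stays below the threshold and the types
are close to the generating distributions. -/
theorem eventually_law_real_atypical_le (P₁ P₂ : PMF 𝒳) {γ κ δ : ℝ} (hγ : 0 < γ) (hκ : 0 < κ)
    (hδ : 0 < δ) (hδ1 : δ ≤ 1) :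
    ∀ᶠ N : ℕ in atTop, (law P₁ P₂ N Hypothesis.H₁).real
      ({ω | ∃ n, 1 ≤ n ∧ n ≤ N ^ 2 ∧ γ * N ≤ score ω.1 ω.2.2 n} ∪
        {ω | ∃ n, 1 ≤ n ∧ n ≤ N ^ 2 ∧ (δ * N ≤ n ∧
          ¬ ∀ a, |empDist ω.2.1 a - pmfReal P₂ a| < κ ∧
            |empDist (firstSamples ω.2.2 n) a - pmfReal P₁ a| < κ)}) ≤
      1 / ((N : ℝ) + 1) ^ 2 := by
  set c := min γ (κ ^ 2 / 4 * δ) with hc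
  have hc0 : 0 < c := lt_min hγ (by positivity)
  -- The factor 2 counts the two events; the extra degree 4 is 2 for the union over n ≤ N² and 2 for
  -- the target (N+1)⁻².
  filter_upwards [eventually_mul_pow_le_exp 2 (3 * Fintype.card 𝒳 + 4) hc0,
    eventually_gt_atTop 0] with N hpoly hN0
  have hN' : (0 : ℝ) < N := by positivity
  have h1 : Real.exp (-(γ * N)) ≤ Real.exp (-(c * N)) :=
    Real.exp_le_exp.2 (neg_le_neg (mul_le_mul_of_nonneg_right (min_le_left _ _) hN'.le))
  have h2 : Real.exp (-(κ ^ 2 / 4 * δ * N)) ≤ Real.exp (-(c * N)) :=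
    Real.exp_le_exp.2 (neg_le_neg (mul_le_mul_of_nonneg_right (min_le_right _ _) hN'.le))
  have h3 := measureReal_exists_le (law P₁ P₂ N Hypothesis.H₁)
    (fun n ω => δ * N ≤ n ∧ ¬ ∀ a, |empDist ω.2.1 a - pmfReal P₂ a| < κ ∧
      |empDist (firstSamples ω.2.2 n) a - pmfReal P₁ a| < κ) (N ^ 2)
    (b := ((N : ℝ) + 1) ^ (3 * Fintype.card 𝒳) * Real.exp (-(c * N))) (by
      intro n hn1 hn2
      by_cases hδn : δ * N ≤ n
      · simp only [hδn, true_and]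
        refine (law_real_types_far P₁ P₂ hδ1 hN0 hn1 hδn hκ).trans ?_
        exact mul_le_mul (types_card_le hn2) h2 (Real.exp_pos _).le (by positivity)
      · simp only [hδn, false_and, Set.ofPred_false, measureReal_empty]
        positivity)
  refine (measureReal_union_le _ _).trans
    ((add_le_add (law_real_exists_le_score_fst P₁ P₂ hN0) h3).trans ?_)
  rw [le_div_iff₀ (by positivity)]
  push_cast
  calc _ ≤ ((N : ℝ) ^ 2 * (((N : ℝ) + 1) ^ (3 * Fintype.card 𝒳) * Real.exp (-(c * N))) +
        (N : ℝ) ^ 2 * (((N : ℝ) + 1) ^ (3 * Fintype.card 𝒳) * Real.exp (-(c * N)))) *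
        ((N : ℝ) + 1) ^ 2 := by gcongr
    _ = 2 * ((N : ℝ) + 1) ^ (3 * Fintype.card 𝒳 + 2) * (N : ℝ) ^ 2 * Real.exp (-(c * N)) := by ring
    _ ≤ 2 * ((N : ℝ) + 1) ^ (3 * Fintype.card 𝒳 + 2) * ((N : ℝ) + 1) ^ 2 *
        Real.exp (-(c * N)) := by
        gcongr
        linarith
    _ = 2 * ((N : ℝ) + 1) ^ (3 * Fintype.card 𝒳 + 4) * Real.exp (-(c * N)) := by ring
    _ ≤ Real.exp (c * N) * Real.exp (-(c * N)) :=
        mul_le_mul_of_nonneg_right hpoly (Real.exp_pos _).le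
    _ = 1 := by rw [← Real.exp_add, add_neg_cancel, Real.exp_zero]

/-- With α = N/n, a crossing by S₂ before (1-ε)N/β would need `gjs` ≥ γα for some α > β/(1-ε):
typicality excludes this up to L, and the logarithmic bound beyond L. At n = ⌊(1+ε)N/β⌋ the ratio α
is slightly below β, so S₂ has crossed. -/
theorem stopTime_bounds_of_typical {𝒳 : Type*} [Fintype 𝒳] {P Q : 𝒳 → ℝ} (hP : P ∈ stdSimplex ℝ 𝒳)
    (hQ : Q ∈ stdSimplex ℝ 𝒳) (hne : P ≠ Q) {γ β ε : ℝ} (hγ : 0 < γ) (hβ : 0 < β)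
    (hroot : gjs P Q β = γ * β) (hε : 0 < ε) (hε1 : ε < 1) :
    ∃ κ : ℝ, 0 < κ ∧ ∃ δ : ℝ, 0 < δ ∧ δ ≤ 1 ∧ ∀ᶠ N : ℕ in atTop, ∀ (x₁ x₂ : Fin N → 𝒳) (y : ℕ → 𝒳),
      (∀ n, 1 ≤ n → n ≤ N ^ 2 → score x₁ y n < γ * N) →
      (∀ n : ℕ, 1 ≤ n → n ≤ N ^ 2 → δ * N ≤ n → ∀ a, |empDist x₂ a - P a| < κ ∧
        |empDist (firstSamples y n) a - Q a| < κ) →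
      (1 - ε) * (N / β) ≤ stopTime γ x₁ x₂ y ∧ stopTime γ x₁ x₂ y ≤ (1 + ε) * (N / β) := by
  obtain ⟨L, hL0, hL⟩ := exists_forall_gjs_lt (𝒳 := 𝒳) hγ
  have h1ε : 0 < 1 - ε := by linarith
  obtain ⟨κ₁, hκ₁, hlow⟩ := exists_forall_near_gjs hP hQ (a := β / (1 - ε)) (b := L)
    (by positivity) (U := {p | p.1 < γ * p.2}) (isOpen_lt (by fun_prop) (by fun_prop))
    fun α hα => gjs_lt_of_root_lt hP hQ hne hβ hroot (lt_of_lt_of_le (by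
      rw [lt_div_iff₀ h1ε]
      nlinarith) hα.1)
  obtain ⟨κ₂, hκ₂, hupp⟩ := exists_forall_near_gjs hP hQ (a := β / (1 + ε))
    (b := β / (1 + ε / 2)) (by positivity) (U := {p | γ * p.2 < p.1})
    (isOpen_lt (by fun_prop) (by fun_prop))
    fun α hα => lt_gjs_of_lt_root hP hQ hne (lt_of_lt_of_le (by positivity) hα.1) hroot
      (hα.2.trans_lt (by
        rw [div_lt_iff₀ (by positivity)]
        nlinarith))
  -- Typicality is used only at times n ≥ N/L (where α ≤ L) and n ≥ N/β.
  refine ⟨min κ₁ κ₂, lt_min hκ₁ hκ₂, min 1 (min L⁻¹ β⁻¹), by positivity, min_le_left _ _, ?_⟩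
  -- The first term makes rounding cost at most (ε/2)N/β; the second puts (1+ε)N/β below the cutoff
  -- N².
  have hlarge : ∀ᶠ N : ℕ in atTop, 2 * β / ε + 2 / β ≤ (N : ℝ) :=
    tendsto_natCast_atTop_atTop.eventually_ge_atTop _
  filter_upwards [hlarge, eventually_gt_atTop 0] with N hNl hN0 x₁ x₂ y hS₁ htyp
  have hN' : (0 : ℝ) < N := by positivity
  have hA := empDist_mem_simplex hN0 x₂
  have hNβ : 1 ≤ ε / 2 * (N / β) := by
    have : 2 * β / ε ≤ N := le_trans (by linarith [show 0 < 2 / β by positivity]) hNl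
    rw [div_le_iff₀ hε] at this
    rw [← mul_div_assoc, le_div_iff₀ hβ]
    linarith
  have hNsq : (1 + ε) * (N / β) ≤ (N : ℝ) ^ 2 := by
    have h2 : 2 / β ≤ N := le_trans (by linarith [show 0 < 2 * β / ε by positivity]) hNl
    calc (1 + ε) * (N / β) ≤ 2 * (N / β) := by gcongr; linarith
      _ = 2 / β * N := by ring
      _ ≤ N * N := by gcongr
      _ = _ := (sq _).symm
  have hNβ0 : 0 < N / β := by positivity
  constructor
  · by_contra! hT
    rcases stopTime_eq_or γ x₁ x₂ y with h | ⟨h1, h2⟩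
    · rw [h] at hT
      push_cast at hT
      nlinarith
    have hTle := stopTime_le (γ := γ) x₁ x₂ y
    set T := stopTime γ x₁ x₂ y
    have h3 : γ * N ≤ score x₂ y T := h2.resolve_left (hS₁ T h1 hTle).not_ge
    have hT0 : (0 : ℝ) < T := by exact_mod_cast h1
    have hB := empDist_mem_simplex h1 (firstSamples y T)
    have h4 : γ * (N / T) ≤ gjs (empDist x₂) (empDist (firstSamples y T)) (N / T) := by
      rw [← mul_div_assoc, div_le_iff₀ hT0]
      exact h3.trans_eq (mul_comm _ _)
    refine h4.not_gt ?_
    rcases le_or_gt L (N / T) with h5 | h5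
    · exact hL _ h5 _ hA _ hB
    · have h6 := htyp T h1 hTle (by
        rw [div_lt_iff₀ hT0] at h5
        have : min 1 (min L⁻¹ β⁻¹) * N ≤ L⁻¹ * N := by
          gcongr
          exact (min_le_right _ _).trans (min_le_left _ _)
        refine this.trans ?_
        rw [inv_mul_le_iff₀ hL0]
        exact h5.le)
      refine hlow _ hA _ hB (fun a => (h6 a).1.trans_le (min_le_left _ _))
        (fun a => (h6 a).2.trans_le (min_le_left _ _)) _ ⟨?_, h5.le⟩
      rw [div_le_div_iff₀ h1ε hT0]
      rw [← mul_div_assoc, lt_div_iff₀ hβ] at hT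
      linarith
  · set n := ⌊(1 + ε) * (N / β)⌋₊ with hn
    have hnle : (n : ℝ) ≤ (1 + ε) * (N / β) := Nat.floor_le (by positivity)
    have hnge : (1 + ε / 2) * (N / β) ≤ n := by
      have := Nat.lt_floor_add_one ((1 + ε) * (N / β))
      rw [← hn] at this
      linarith
    have hn0 : (0 : ℝ) < n := lt_of_lt_of_le (by positivity) hnge
    have hn1 : 1 ≤ n := by exact_mod_cast hn0
    have hn2 : n ≤ N ^ 2 := by exact_mod_cast hnle.trans hNsq
    have h6 := htyp n hn1 hn2 (by
      have : min 1 (min L⁻¹ β⁻¹) * N ≤ β⁻¹ * N := by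
        gcongr
        exact (min_le_right _ _).trans (min_le_right _ _)
      refine (this.trans ?_).trans hnge
      rw [inv_mul_eq_div]
      nlinarith)
    have h7 : γ * (N / n) < gjs (empDist x₂) (empDist (firstSamples y n)) (N / n) := by
      refine hupp _ hA _ (empDist_mem_simplex hn1 _) (fun a => (h6 a).1.trans_le (min_le_right _ _))
        (fun a => (h6 a).2.trans_le (min_le_right _ _)) _ ⟨?_, ?_⟩
      · rw [div_le_div_iff₀ (by positivity) hn0]
        rw [← mul_div_assoc, le_div_iff₀ hβ] at hnle
        linarith
      · rw [div_le_div_iff₀ hn0 (by positivity)]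
        rw [← mul_div_assoc, div_le_iff₀ hβ] at hnge
        linarith
    refine le_trans ?_ hnle
    rw [← mul_div_assoc, div_lt_iff₀ hn0] at h7
    exact_mod_cast stopTime_le_of_le_score hn1 (h7.le.trans_eq (mul_comm _ _))

theorem expStopTime_bounds_of_prob (P₁ P₂ : PMF 𝒳) (γ : ℝ) (N : ℕ) {lo hi p : ℝ}
    (hlo : 0 ≤ lo) (hhi : 0 ≤ hi)
    (hp : (law P₁ P₂ N Hypothesis.H₁).real {ω | ¬ (lo ≤ stopTime γ ω.1 ω.2.1 ω.2.2 ∧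
      stopTime γ ω.1 ω.2.1 ω.2.2 ≤ hi)} ≤ p) :
    lo * (1 - p) ≤ expStopTime P₁ P₂ γ N Hypothesis.H₁ ∧
      expStopTime P₁ P₂ γ N Hypothesis.H₁ ≤ hi + (N : ℝ) ^ 2 * p := by
  set μ := law P₁ P₂ N Hypothesis.H₁
  set B := {ω : (Fin N → 𝒳) × (Fin N → 𝒳) × (ℕ → 𝒳) |
    ¬ (lo ≤ stopTime γ ω.1 ω.2.1 ω.2.2 ∧ stopTime γ ω.1 ω.2.1 ω.2.2 ≤ hi)} with hBdef
  have hmeas : Measurable fun ω : (Fin N → 𝒳) × (Fin N → 𝒳) × (ℕ → 𝒳) =>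
      (stopTime γ ω.1 ω.2.1 ω.2.2 : ℝ) :=
    (measurable_of_countable (fun n : ℕ => (n : ℝ))).comp (measurable_stopTime γ N)
  have hB : MeasurableSet B :=
    ((measurableSet_le measurable_const hmeas).inter (measurableSet_le hmeas measurable_const)).compl
  have hbound : ∀ ω : (Fin N → 𝒳) × (Fin N → 𝒳) × (ℕ → 𝒳),
      (stopTime γ ω.1 ω.2.1 ω.2.2 : ℝ) ≤ (N : ℝ) ^ 2 :=
    fun ω => by exact_mod_cast stopTime_le ω.1 ω.2.1 ω.2.2
  have hint : Integrable (fun ω : (Fin N → 𝒳) × (Fin N → 𝒳) × (ℕ → 𝒳) =>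
      (stopTime γ ω.1 ω.2.1 ω.2.2 : ℝ)) μ :=
    Integrable.of_bound hmeas.aestronglyMeasurable ((N : ℝ) ^ 2) <| .of_forall fun ω => by
      rw [Real.norm_of_nonneg (Nat.cast_nonneg _)]
      exact hbound ω
  constructor
  · calc lo * (1 - p) ≤ lo * μ.real Bᶜ := by
          rw [probReal_compl_eq_one_sub hB]
          gcongr
      _ = ∫ ω, Bᶜ.indicator (fun _ => lo) ω ∂μ := by
          rw [integral_indicator_const _ hB.compl, smul_eq_mul, mul_comm]
      _ ≤ _ := by
          refine integral_mono ((integrable_const lo).indicator hB.compl) hint fun ω => ?_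
          by_cases hω : ω ∈ B
          · simp [hω]
          · have h := not_not.1 hω
            simpa [hω] using h.1
  · calc expStopTime P₁ P₂ γ N Hypothesis.H₁
        ≤ ∫ ω, (hi + B.indicator (fun _ => (N : ℝ) ^ 2) ω) ∂μ := by
          refine integral_mono hint
            ((integrable_const hi).add ((integrable_const _).indicator hB)) fun ω => ?_
          by_cases hω : ω ∈ B
          · simpa [hω] using (hbound ω).trans (le_add_of_nonneg_left hhi)
          · have h := not_not.1 hω
            simpa [hω] using h.2
      _ = hi + (N : ℝ) ^ 2 * μ.real B := by
          rw [integral_add (integrable_const _) ((integrable_const _).indicator hB),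
            integral_indicator_const _ hB, integral_const, probReal_univ]
          simp [mul_comm]
      _ ≤ _ := by gcongr

theorem expStopTime_isEquivalent (P₁ P₂ : PMF 𝒳) (hne : pmfReal P₂ ≠ pmfReal P₁) {γ β : ℝ}
    (hγ : 0 < γ) (hβ : 0 < β) (hroot : gjs (pmfReal P₂) (pmfReal P₁) β = γ * β) :
    (fun N => expStopTime P₁ P₂ γ N Hypothesis.H₁) ~[atTop] (fun N => (N : ℝ) / β) := by
  refine IsLittleO.of_bound fun c hc => ?_
  -- Each side loses ε twice, once from the window and once from the exceptional event: (1-ε)² ≥ 1 -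
  -- c and 1 + 2ε ≤ 1 + c.
  set ε := min (c / 2) (1 / 2) with hε
  have hε0 : 0 < ε := by positivity
  have hεc : ε ≤ c / 2 := min_le_left _ _
  have hε1 : ε ≤ 1 / 2 := min_le_right _ _
  obtain ⟨κ, hκ, δ, hδ, hδ1, hev⟩ := stopTime_bounds_of_typical (pmfReal_mem_simplex P₂)
    (pmfReal_mem_simplex P₁) hne hγ hβ hroot hε0 (by linarith)
  have hlarge : ∀ᶠ N : ℕ in atTop, β / ε + 1 / ε ≤ (N : ℝ) :=
    tendsto_natCast_atTop_atTop.eventually_ge_atTop _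
  filter_upwards [hev, eventually_law_real_atypical_le P₁ P₂ hγ hκ hδ hδ1, hlarge]
    with N hN hprob hNl
  have hβε : 0 < β / ε := by positivity
  have h1ε : 0 < 1 / ε := by positivity
  have hN' : (0 : ℝ) < N := by linarith
  have hNβ0 : 0 < N / β := by positivity
  have hp : (law P₁ P₂ N Hypothesis.H₁).real
      {ω | ¬ ((1 - ε) * (N / β) ≤ stopTime γ ω.1 ω.2.1 ω.2.2 ∧
        stopTime γ ω.1 ω.2.1 ω.2.2 ≤ (1 + ε) * (N / β))} ≤ 1 / ((N : ℝ) + 1) ^ 2 := by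
    refine le_trans (measureReal_mono ?_ (measure_ne_top _ _)) hprob
    rintro ⟨x₁, x₂, y⟩ hω
    by_contra hgood
    simp only [Set.mem_union, not_or] at hgood
    refine hω (hN x₁ x₂ y (fun n h1 h2 => lt_of_not_ge fun h => hgood.1 ⟨n, h1, h2, h⟩) ?_)
    intro n h1 h2 h3
    by_contra h
    exact hgood.2 ⟨n, h1, h2, h3, h⟩
  obtain ⟨hlow, hupp⟩ := expStopTime_bounds_of_prob P₁ P₂ γ N
    (mul_nonneg (by linarith) hNβ0.le) (by positivity) hp
  have h1 : (N : ℝ) ^ 2 * (1 / ((N : ℝ) + 1) ^ 2) ≤ 1 := by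
    rw [mul_one_div, div_le_one (by positivity)]
    gcongr
    linarith
  have h2 : 1 ≤ ε * (N / β) := by
    have : β / ε ≤ N := by linarith
    rw [div_le_iff₀ hε0] at this
    rw [← mul_div_assoc, le_div_iff₀ hβ]
    linarith
  have h3 : 1 / ((N : ℝ) + 1) ^ 2 ≤ ε := by
    have : 1 / ε ≤ N := by linarith
    rw [div_le_iff₀ hε0] at this
    rw [div_le_iff₀ (by positivity)]
    nlinarith
  have h4 : (1 - ε) * (N / β) * (1 - ε) ≤ (1 - ε) * (N / β) * (1 - 1 / ((N : ℝ) + 1) ^ 2) :=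
    mul_le_mul_of_nonneg_left (by linarith) (mul_nonneg (by linarith) hNβ0.le)
  rw [Pi.sub_apply, Real.norm_eq_abs, Real.norm_of_nonneg hNβ0.le, abs_le]
  constructor
  · nlinarith [mul_pos (mul_pos hε0 hε0) hNβ0, mul_le_mul_of_nonneg_right hεc hNβ0.le]
  · nlinarith [mul_le_mul_of_nonneg_right hεc hNβ0.le]

end StoppingTime

/-! ### Reduction of H₂ to H₁ by exchanging training sequences and decisions. -/

section Swap

variable {𝒳 : Type*} [Fintype 𝒳] [MeasurableSpace 𝒳]

/-- The exchange of the two training sequences. -/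
def swapTraining (𝒳 : Type*) [MeasurableSpace 𝒳] (N : ℕ) :
    (Fin N → 𝒳) × (Fin N → 𝒳) × (ℕ → 𝒳) ≃ᵐ (Fin N → 𝒳) × (Fin N → 𝒳) × (ℕ → 𝒳) :=
  (MeasurableEquiv.prodAssoc.symm.trans
    (MeasurableEquiv.prodCongr MeasurableEquiv.prodComm (MeasurableEquiv.refl _))).trans
      MeasurableEquiv.prodAssoc

theorem swapTraining_apply {𝒳 : Type*} [MeasurableSpace 𝒳] {N : ℕ} (ω : (Fin N → 𝒳) × (Fin N → 𝒳) × (ℕ → 𝒳)) :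
    swapTraining 𝒳 N ω = (ω.2.1, ω.1, ω.2.2) := rfl

theorem measurePreserving_swapTraining (P₁ P₂ : PMF 𝒳) (N : ℕ) :
    MeasurePreserving (swapTraining 𝒳 N) (law P₁ P₂ N Hypothesis.H₂)
      (law P₂ P₁ N Hypothesis.H₁) := by
  unfold law swapTraining
  refine (measurePreserving_prodAssoc _ _ _).comp
    (MeasurePreserving.comp (g := Prod.map Prod.swap id) ?_
      ((measurePreserving_prodAssoc _ _ _).symm _))
  exact Measure.measurePreserving_swap.prod (MeasurePreserving.id _)

theorem stopTime_comm {𝒳 : Type*} [Fintype 𝒳] (γ : ℝ) {N : ℕ} (x₁ x₂ : Fin N → 𝒳) (y : ℕ → 𝒳) :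
    stopTime γ x₁ x₂ y = stopTime γ x₂ x₁ y := by
  simp only [stopTime, or_comm]

theorem expStopTime_swap (P₁ P₂ : PMF 𝒳) (γ : ℝ) (N : ℕ) :
    expStopTime P₁ P₂ γ N Hypothesis.H₂ = expStopTime P₂ P₁ γ N Hypothesis.H₁ := by
  unfold expStopTime
  rw [← (measurePreserving_swapTraining P₁ P₂ N).integral_comp']
  simp only [swapTraining_apply]
  exact integral_congr_ae (.of_forall fun ω => by simp only [stopTime_comm γ ω.1])

/-- The hypothesis other than the given one. -/
def Hypothesis.other : Hypothesis → Hypothesis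
  | Hypothesis.H₁ => Hypothesis.H₂
  | Hypothesis.H₂ => Hypothesis.H₁

theorem errProb_swap (P₁ P₂ : PMF 𝒳) (N : ℕ)
    (d : (Fin N → 𝒳) → (Fin N → 𝒳) → (ℕ → 𝒳) → Hypothesis) :
    errProb P₁ P₂ N d Hypothesis.H₂ =
      errProb P₂ P₁ N (fun x₁ x₂ y => (d x₂ x₁ y).other) Hypothesis.H₁ := by
  unfold errProb Measure.real
  rw [← (measurePreserving_swapTraining P₁ P₂ N).measure_preimage_equiv]
  congr 2
  ext ω
  simp only [Set.mem_preimage, Set.mem_ofPred_eq, swapTraining_apply]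
  cases d ω.1 ω.2.1 ω.2.2 <;> simp [Hypothesis.other]

end Swap

end SeqClassification

/-! ### Assembly of the theorem. -/

open SeqClassification in
theorem theorem2 {𝒳 : Type*} [Fintype 𝒳] [MeasurableSpace 𝒳] [MeasurableSingletonClass 𝒳]
    (P₁ P₂ : PMF 𝒳) (γ : ℝ) (hγ : 0 < γ) (hγC : (γ : EReal) ≤ chernoffInfo P₁ P₂)
    (hsupp : (γ : EReal) = chernoffInfo P₁ P₂ → P₁.support = P₂.support) :
    (∃! β : ℝ, 0 < β ∧ gjs (pmfReal P₂) (pmfReal P₁) β = γ * β) ∧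
    (∃! θ : ℝ, 0 < θ ∧ gjs (pmfReal P₁) (pmfReal P₂) θ = γ * θ) ∧
    ∀ β θ : ℝ,
      (0 < β ∧ gjs (pmfReal P₂) (pmfReal P₁) β = γ * β) →
      (0 < θ ∧ gjs (pmfReal P₁) (pmfReal P₂) θ = γ * θ) →
      ∀ d : (N : ℕ) → (Fin N → 𝒳) → (Fin N → 𝒳) → (ℕ → 𝒳) → Hypothesis,
        (∀ N, IsSeqRule γ N (d N)) →
        ExpLE (fun N => errProb P₁ P₂ N (d N) Hypothesis.H₁) (fun N => Real.exp (-(N * γ))) ∧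
        (fun N => expStopTime P₁ P₂ γ N Hypothesis.H₁) ~[atTop] (fun N => (N : ℝ) / β) ∧
        ExpLE (fun N => errProb P₁ P₂ N (d N) Hypothesis.H₂) (fun N => Real.exp (-(N * γ))) ∧
        (fun N => expStopTime P₁ P₂ γ N Hypothesis.H₂) ~[atTop] (fun N => (N : ℝ) / θ) := by
  obtain ⟨η, h0, h1, hη⟩ := exists_chernoff_sum_le P₁ P₂ hγ hγC hsupp
  -- The Chernoff sum is symmetric under P₁ ↔ P₂, η ↔ 1 - η, so one interior exponent serves both
  -- hypotheses.
  have hη' : ∑ a, pmfReal P₂ a ^ (1 - η) * pmfReal P₁ a ^ (1 - (1 - η)) ≤ Real.exp (-γ) := by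
    simpa only [sub_sub_cancel, mul_comm] using hη
  have hP₁ := pmfReal_mem_simplex P₁
  have hP₂ := pmfReal_mem_simplex P₂
  have hne : pmfReal P₂ ≠ pmfReal P₁ :=
    ne_of_chernoff_sum_lt_one hP₂ (hη.trans_lt (by simpa using hγ))
  refine ⟨existsUnique_gjs_eq hP₂ hP₁ hγ h0 h1 hη,
    existsUnique_gjs_eq hP₁ hP₂ hγ (by linarith) (by linarith) hη', ?_⟩
  rintro β θ ⟨hβ, hβ'⟩ ⟨hθ, hθ'⟩ d hd
  refine ⟨expLE_errProb P₁ P₂ hγ h0 h1 hη fun N => (hd N).declare₁,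
    expStopTime_isEquivalent P₁ P₂ hne hγ hβ hβ', ?_, ?_⟩
  · simp only [errProb_swap]
    refine expLE_errProb P₂ P₁ (d := fun N x₁ x₂ y => (d N x₂ x₁ y).other) hγ
      (by linarith) (by linarith) hη' fun N x₁ x₂ y h h' => ?_
    rw [stopTime_comm] at h h'
    rw [(hd N).declare₂ x₂ x₁ y h h']
    rfl
  · simp only [expStopTime_swap]
    exact expStopTime_isEquivalent P₂ P₁ hne.symm hγ hθ hθ'
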